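/- Consider two particles with masses $\mu_1,\mu_2>0$ on the Lobachevsky plane $L^2=\{R=(X,Y,Z)\in\mathbb{R}^3: X^2+Y^2-Z^2=-1,\ Z>0\}$ with the metric induced by $\langle x,y\rangle_K=(x,Ky)$, $K=\mathrm{diag}(1,1,-1)$, interacting through the gravitational potential $U(q)=-G\mu_1\mu_2/\tanh q$, $G>0$, where $q>0$ is the Riemannian distance between them. Put $\mu=\mu_1/\mu_2$. Modulo the symmetry group $SO(2,1)$ the motion is governed by the reduced system on $\mathbb{R}^3\times(0,\infty)\times\mathbb{R}\ni(m,q,p)$, $$\dot m=(Km)\times\frac{\partial H}{\partial m},\qquad \dot q=\frac{\partial H}{\partial p},\qquad \dot p=-\frac{\partial H}{\partial q},$$ $$H(m,q,p)=\frac1{2\mu_1}\Bigl((m,A(q)m)-2m_xp+(1+\mu)p^2\Bigr)+U(q),\qquad A(q)=\begin{pmatrix}1&0&0\\0&1&-\coth q\\0&-\coth q&\dfrac{\mu+\cosh^2q}{\sinh^2q}\end{pmatrix}.$$ Here $m$ is the angular momentum in the moving frame $g\in SO(2,1)$ in which the particles have coordinates $(0,0,1)$ and $(0,\sinh q,\cosh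 q)$, and $p$ is the momentum conjugate to $q$. The function $C(m)=-\langle m,m\rangle_K$ is a first integral. A relative equilibrium is a motion of the two particles that coincides with the action of a nontrivial one-parameter subgroup of $SO(2,1)$; it is called elliptic (hyperbolic) if this subgroup fixes a timelike (spacelike) vector, i.e. consists of rotations about a point of $L^2$ (of translations along a geodesic). Its reduced state $(m,q,p)$ is an equilibrium of the reduced system, and the stability of the relative equilibrium is by definition that of this equilibrium. It is called nonlinearly stable if it is stable in the sense of Lyapunov, and linearly unstable if the linearized reduced system has an eigenvalue with positive real part. Then: 1. All hyperbolic relative equilibria are linearly unstable; they are also unstable in the sense of Lyapunov, even with respect to perturbations of the reduced initial state that preserve the value of $C$. 2. The equation $$2\sinh^2\alpha+1=2\sinh^2\alpha\,\sqrt{1+\mu^2\sinh^2 2\alpha}$$ has a unique positive solution $\alpha^*$. Put $q^*=\alpha^*+\tfrac12\operatorname{arcsinh}(\mu\sinh2\alpha^*)$. Then $q^*>0$, and an elliptic relative equilibrium in which the particles are at distance $q$ is nonlinearly stable if $q<q^*$, and unstable if $q>q^*$: it is then linearly unstable, and unstable in the sense of Lyapunov, even with respect to perturbations of the reduced initial state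 that preserve the value of $C$. -/

import Mathlib

open scoped Matrix

noncomputable section

namespace LobachevskyTwoBody

/-! ### Minkowski space and the Lobachevsky plane -/

/-- Vectors of the three-dimensional Minkowski space. -/
abbrev Vec := Fin 3 → ℝ

/-- The matrix `K = diag(1, 1, -1)`. -/
def K : Matrix (Fin 3) (Fin 3) ℝ := Matrix.diagonal ![1, 1, -1]

/-- The Minkowski scalar product `⟨x, y⟩_K = (x, K y)`. -/
def mink (x y : Vec) : ℝ := x ⬝ᵥ (K *ᵥ y)

/-- The Lobachevsky plane: the upper sheet of the hyperboloid `X² + Y² - Z² = -1`. -/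
def plane : Set Vec := {R | mink R R = -1 ∧ 0 < R 2}

/-- The Riemannian distance of two points of the Lobachevsky plane: `cosh d = -⟨x, y⟩_K`. -/
def hdist (x y : Vec) : ℝ := Real.arcosh (-mink x y)

/-! ### The two-body problem -/

/-- The gravitational potential on the Lobachevsky plane. -/
def gravPotential (G μ₁ μ₂ : ℝ) (q : ℝ) : ℝ := -(G * μ₁ * μ₂) / Real.tanh q

/-- `t ↦ (R₁ t, R₂ t)` is a collision-free motion of the two-body problem on the Lobachevsky plane
with masses `μ₁`, `μ₂` and potential energy `U (hdist R₁ R₂)`. The equation of motion says that for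
each particle, mass times covariant acceleration (the tangential part of the second derivative) is
minus the Riemannian gradient of the potential energy with respect to its position; it is tested
against all vectors `w` that are tangent to the plane at that position. -/
structure IsMotion (μ₁ μ₂ : ℝ) (U : ℝ → ℝ) (R₁ R₂ : ℝ → Vec) : Prop where
  smooth₁ : ContDiff ℝ 2 R₁
  smooth₂ : ContDiff ℝ 2 R₂
  mem₁ : ∀ t, R₁ t ∈ plane
  mem₂ : ∀ t, R₂ t ∈ plane
  noCollision : ∀ t, R₁ t ≠ R₂ t
  newton₁ : ∀ t w, mink (R₁ t) w = 0 →
    μ₁ * mink (deriv (deriv R₁) t) w = -(fderiv ℝ (fun x => U (hdist x (R₂ t))) (R₁ t) w)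
  newton₂ : ∀ t w, mink (R₂ t) w = 0 →
    μ₂ * mink (deriv (deriv R₂) t) w = -(fderiv ℝ (fun x => U (hdist (R₁ t) x)) (R₂ t) w)

/-- `ξ` belongs to the Lie algebra `so(2,1)`. -/
def IsGenerator (ξ : Matrix (Fin 3) (Fin 3) ℝ) : Prop := ξᵀ * K + K * ξ = 0

/-- A relative equilibrium: a motion that coincides with the action of the one-parameter subgroup
`t ↦ exp (t ξ)` of `SO(2,1)` on both particles. -/
def IsRelativeEquilibrium (μ₁ μ₂ : ℝ) (U : ℝ → ℝ) (ξ : Matrix (Fin 3) (Fin 3) ℝ)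
    (R₁ R₂ : ℝ → Vec) : Prop :=
  IsMotion μ₁ μ₂ U R₁ R₂ ∧ IsGenerator ξ ∧
    ∀ t, R₁ t = NormedSpace.exp (t • ξ) *ᵥ R₁ 0 ∧ R₂ t = NormedSpace.exp (t • ξ) *ᵥ R₂ 0

/-- `ξ` generates an elliptic one-parameter subgroup: a nontrivial one that fixes a timelike vector,
so that it consists of the rotations about a point of the Lobachevsky plane. -/
def IsElliptic (ξ : Matrix (Fin 3) (Fin 3) ℝ) : Prop :=
  IsGenerator ξ ∧ ξ ≠ 0 ∧ ∃ n : Vec, mink n n < 0 ∧ ξ *ᵥ n = 0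

/-- `ξ` generates a hyperbolic one-parameter subgroup: a nontrivial one that fixes a spacelike
vector, so that it consists of the translations along a geodesic of the Lobachevsky plane. -/
def IsHyperbolic (ξ : Matrix (Fin 3) (Fin 3) ℝ) : Prop :=
  IsGenerator ξ ∧ ξ ≠ 0 ∧ ∃ n : Vec, 0 < mink n n ∧ ξ *ᵥ n = 0

/-! ### The reduced system -/

/-- The vector space with coordinates `(m, q, p)`. -/
abbrev RedVec := Vec × ℝ × ℝ

/-- The reduced phase space `ℝ³ × (0, ∞) × ℝ`. -/
def redSpace : Set RedVec := {z | 0 < z.2.1}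

/-- The matrix `A(q)` of the reduced kinetic energy, for the mass ratio `μ`. -/
def inertia (μ q : ℝ) : Matrix (Fin 3) (Fin 3) ℝ :=
  !![1, 0, 0;
     0, 1, -(Real.cosh q / Real.sinh q);
     0, -(Real.cosh q / Real.sinh q), (μ + Real.cosh q ^ 2) / Real.sinh q ^ 2]

/-- The reduced Hamiltonian. -/
def hamiltonian (μ₁ μ₂ : ℝ) (U : ℝ → ℝ) (m : Vec) (q p : ℝ) : ℝ :=
  1 / (2 * μ₁) * (m ⬝ᵥ (inertia (μ₁ / μ₂) q *ᵥ m) - 2 * m 0 * p + (1 + μ₁ / μ₂) * p ^ 2) + U q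

/-- The reduced equations of motion
`m' = (K m) × ∂H/∂m`, `q' = ∂H/∂p`, `p' = -∂H/∂q`. -/
def redField (μ₁ μ₂ : ℝ) (U : ℝ → ℝ) (z : RedVec) : RedVec :=
  ((K *ᵥ z.1) ⨯₃
      (fun i => fderiv ℝ (fun m => hamiltonian μ₁ μ₂ U m z.2.1 z.2.2) z.1 (Pi.single i 1)),
    deriv (fun p => hamiltonian μ₁ μ₂ U z.1 z.2.1 p) z.2.2,
    -deriv (fun q => hamiltonian μ₁ μ₂ U z.1 q z.2.2) z.2.1)

/-- The Casimir function `C = -⟨m, m⟩_K`; its regular level sets are the symplectic leaves. -/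
def casimir (z : RedVec) : ℝ := -mink z.1 z.1

/-- The angular momentum in the fixed frame, of particles at `x₁`, `x₂` with velocities
`v₁`, `v₂`. -/
def angularMomentum (μ₁ μ₂ : ℝ) (x₁ x₂ v₁ v₂ : Vec) : Vec :=
  μ₁ • ((K *ᵥ x₁) ⨯₃ (K *ᵥ v₁)) + μ₂ • ((K *ᵥ x₂) ⨯₃ (K *ᵥ v₂))

/-- `z = (m, q, p)` is the point of the reduced space that belongs to the particles at `x₁`, `x₂`
with velocities `v₁`, `v₂`. The moving frame `g ∈ SO(2,1)` is the one in which the particles have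
the coordinates `(0, 0, 1)` and `(0, sinh q, cosh q)`; `m` is the angular momentum in the moving
frame, and `p` is the momentum conjugate to `q`, that is, the scalar product of `μ₂ v₂` with the
derivative of `x₂ = g (0, sinh q, cosh q)` with respect to `q`. -/
def IsReducedState (μ₁ μ₂ : ℝ) (x₁ x₂ v₁ v₂ : Vec) (z : RedVec) : Prop :=
  z ∈ redSpace ∧ ∃ g : Matrix (Fin 3) (Fin 3) ℝ, gᵀ * K * g = K ∧ g.det = 1 ∧
    x₁ = g *ᵥ ![0, 0, 1] ∧
    x₂ = g *ᵥ ![0, Real.sinh z.2.1, Real.cosh z.2.1] ∧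
    angularMomentum μ₁ μ₂ x₁ x₂ v₁ v₂ = g *ᵥ z.1 ∧
    z.2.2 = μ₂ * mink v₂ (g *ᵥ ![0, Real.cosh z.2.1, Real.sinh z.2.1])

/-! ### Stability -/

section Stability

variable {E : Type*} [NormedAddCommGroup E] [NormedSpace ℝ E]

/-- `γ` solves `z' = X z` on the time interval `s`, inside the phase space `D`. -/
def IsSolutionOn (X : E → E) (D : Set E) (γ : ℝ → E) (s : Set ℝ) : Prop :=
  ∀ t ∈ s, γ t ∈ D ∧ HasDerivWithinAt γ (X (γ t)) s t

/-- `z₀` is a (nonlinearly, Lyapunov) stable equilibrium of `z' = X z` on the phase space `D`: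
a solution that starts near `z₀` exists for all positive times and stays near `z₀`. -/
def IsLyapunovStable (X : E → E) (D : Set E) (z₀ : E) : Prop :=
  z₀ ∈ D ∧ X z₀ = 0 ∧ ∀ ε > 0, ∃ δ > 0, ∀ z ∈ D, dist z z₀ < δ →
    (∃ γ : ℝ → E, γ 0 = z ∧ IsSolutionOn X D γ (Set.Ici 0)) ∧
    ∀ (γ : ℝ → E) (T : ℝ), 0 ≤ T → γ 0 = z → IsSolutionOn X D γ (Set.Icc 0 T) →
      ∀ t ∈ Set.Icc 0 T, dist (γ t) z₀ < ε

/-- `z₀` is an equilibrium of `z' = X z` on the phase space `D` that is not Lyapunov stable, even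
with respect to perturbations in `S` of the initial state: there are solutions starting in `S`,
arbitrarily near `z₀`, that leave a fixed neighbourhood of `z₀`. -/
def IsLyapunovUnstableWithin (X : E → E) (D S : Set E) (z₀ : E) : Prop :=
  z₀ ∈ D ∧ X z₀ = 0 ∧ ∃ ε > 0, ∀ δ > 0, ∃ (γ : ℝ → E) (T : ℝ), 0 ≤ T ∧
    IsSolutionOn X D γ (Set.Icc 0 T) ∧ γ 0 ∈ S ∧ dist (γ 0) z₀ < δ ∧ ε ≤ dist (γ T) z₀

/-- `z₀` is a linearly unstable equilibrium of `z' = X z` on the phase space `D`: the linearization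
has an eigenvalue with positive real part. -/
def IsLinearlyUnstable (X : E → E) (D : Set E) (z₀ : E) : Prop :=
  z₀ ∈ D ∧ X z₀ = 0 ∧ ∃ l : ℂ, 0 < l.re ∧
    Module.End.HasEigenvalue
      (LinearMap.baseChange ℂ (fderiv ℝ X z₀ : E →ₗ[ℝ] E) : Module.End ℂ (TensorProduct ℝ ℂ E)) l

end Stability

end LobachevskyTwoBody

end

open LobachevskyTwoBody

/-!
In the moving frame a relative equilibrium has angular momentum `m = (0, r Z, Z)` and `p = 0`, where
`r` compares the generator of the motion with the frame: `r = tanh α < 1` in the elliptic case,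
where `α` is the distance of the first particle to the centre of rotation, and `r > 1` in the
hyperbolic case. Newton's equations and the equilibrium equations of the reduced system are then the
same two relations between `r`, `Z` and `coth q`.

The reduced field preserves `H` and `C`, and its linearization on the four-dimensional symplectic
leaf through such an equilibrium splits, up to the Casimir direction, into two planes exchanged by
the field. Stability is decided by the sign of a `2 × 2` determinant `S₁₁ S₂₂ - S₁₂²`. If it is
positive, then `H` plus a multiple of `C` plus a multiple of the square of `C - C(z)` has a strict
minimum and is a Lyapunov function; if it is negative, the linearization has a pair of real
eigenvalues of opposite sign, and a quadratic form in the corresponding eigencovectors is a Chetaev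
function. The determinant has the sign of `(1 + r²)² - 4 r³ (1 + μ) coth q`, which is negative for
`r > 1`, and for `r = tanh α` equals `1 - 2 sinh² α (√(1 + μ² sinh² 2α) - 1)` divided by
`cosh⁴ α`. This changes sign once, from positive to negative, as `α` increases, and with it the
distance `q = α + arsinh (μ sinh 2α) / 2`.
-/

noncomputable section

namespace LobachevskyTwoBody

section ODE

open Set Metric Filter Topology Manifold

variable {E : Type*} [NormedAddCommGroup E] [NormedSpace ℝ E] {X : E → E} {D : Set E}

theorem exists_forall_hasDerivAt_of_hasCompactSupport [CompleteSpace E]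
    (hX : ContDiff ℝ 1 X) (hsupp : HasCompactSupport X) (z : E) :
    ∃ γ : ℝ → E, γ 0 = z ∧ ∀ t, HasDerivAt γ (X (γ t)) t := by
  obtain ⟨K, hK⟩ := hX.lipschitzWith_of_hasCompactSupport hsupp one_ne_zero
  obtain ⟨L, hL⟩ := hsupp.exists_bound_of_continuous hX.continuous
  have hlocal (a : ℝ) : ∃ γ : ℝ → E, γ 0 = z ∧
      IsMIntegralCurveOn (I := 𝓘(ℝ, E)) γ X (Ioo (-a) a) := by
    obtain ha | ha := lt_or_ge 0 a
    · have hPicard : IsPicardLindelof (fun _ => X) (⟨0, by simp [ha.le]⟩ : Icc (-a) a) z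
          (L.toNNReal * a.toNNReal) 0 L.toNNReal K :=
        { lipschitzOnWith := fun _ _ => hK.lipschitzOnWith
          continuousOn := fun _ _ => continuousOn_const
          norm_le := fun _ _ x _ => (hL x).trans (Real.le_coe_toNNReal L)
          mul_max_le := by simp [ha.le] }
      obtain ⟨γ, hγ₀, hγ⟩ := hPicard.exists_eq_forall_mem_Icc_hasDerivWithinAt₀
      exact ⟨γ, hγ₀, fun t ht => hasMFDerivWithinAt_iff_hasFDerivWithinAt.2
        ((hγ t (Ioo_subset_Icc_self ht)).mono Ioo_subset_Icc_self).hasFDerivWithinAt⟩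
    · exact ⟨fun _ => z, rfl, fun t ht => by linarith [ht.1, ht.2]⟩
  obtain ⟨γ, hγ₀, hγ⟩ := (exists_isMIntegralCurve_iff_exists_isMIntegralCurveOn_Ioo
    (contMDiff_vectorSpace_iff_contDiff.2 hX) z).2 hlocal
  exact ⟨γ, hγ₀, fun t => hasDerivAt_iff_hasFDerivAt.2
    ((hasMFDerivAt_iff_hasFDerivAt.1 (hγ t)).congr_fderiv rfl)⟩

theorem exists_contDiff_hasCompactSupport_eqOn_closedBall [FiniteDimensional ℝ E]
    (hD : IsOpen D) (hX : ∀ z ∈ D, ContDiffAt ℝ 1 X z) {z₀ : E} (hz₀ : z₀ ∈ D) :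
    ∃ (Y : E → E) (r : ℝ), 0 < r ∧ closedBall z₀ r ⊆ D ∧ ContDiff ℝ 1 Y ∧
      HasCompactSupport Y ∧ EqOn Y X (closedBall z₀ r) := by
  obtain ⟨r, hr, hrD⟩ := nhds_basis_closedBall.mem_iff.1 (hD.mem_nhds hz₀)
  let χ : ContDiffBump z₀ := ⟨r / 2, r, half_pos hr, half_lt_self hr⟩
  refine ⟨fun z => χ z • X z, r / 2, half_pos hr,
    (closedBall_subset_closedBall (half_le_self hr.le)).trans hrD,
    contDiff_iff_contDiffAt.2 fun x => ?_, χ.hasCompactSupport.smul_right,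
    fun z hz => by simp only [χ.one_of_mem_closedBall hz, one_smul]⟩
  by_cases hx : x ∈ tsupport χ
  · exact χ.contDiffAt.smul (hX x (hrD (χ.tsupport_eq ▸ hx)))
  · exact (contDiffAt_const (c := 0)).congr_of_eventuallyEq
      ((notMem_tsupport_iff_eventuallyEq.1 hx).mono fun y hy => by simp [hy])

theorem exists_first_hitting_time {f : ℝ → ℝ} (hf : Continuous f) {ε t : ℝ} (h₀ : f 0 < ε)
    (ht : 0 ≤ t) (hft : ε ≤ f t) : ∃ T, 0 ≤ T ∧ f T = ε ∧ ∀ s ∈ Icc 0 T, f s ≤ ε := by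
  have hcross {s : ℝ} (hs : 0 ≤ s) (hfs : ε ≤ f s) : ∃ u ∈ Icc 0 s, f u = ε :=
    intermediate_value_Icc hs hf.continuousOn ⟨h₀.le, hfs⟩
  let A := {s : ℝ | 0 ≤ s ∧ f s = ε}
  have hbdd : BddBelow A := ⟨0, fun s hs => hs.1⟩
  have hmem : sInf A ∈ A :=
    (isClosed_Ici.inter (isClosed_eq hf continuous_const)).csInf_mem
      (let ⟨u, hu, hfu⟩ := hcross ht hft; ⟨u, hu.1, hfu⟩) hbdd
  refine ⟨sInf A, hmem.1, hmem.2, fun s hs => ?_⟩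
  by_contra! hlt
  obtain ⟨u, hu, hfu⟩ := hcross hs.1 hlt.le
  have hus : u = s := le_antisymm hu.2 (hs.2.trans (csInf_le hbdd ⟨hu.1, hfu⟩))
  exact hlt.ne' (hus ▸ hfu)

theorem IsSolutionOn.mono {γ : ℝ → E} {s t : Set ℝ} (h : IsSolutionOn X D γ t) (hst : s ⊆ t) :
    IsSolutionOn X D γ s :=
  fun u hu => ⟨(h u (hst hu)).1, (h u (hst hu)).2.mono hst⟩

theorem IsSolutionOn.continuousOn {γ : ℝ → E} {s : Set ℝ} (h : IsSolutionOn X D γ s) :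
    ContinuousOn γ s :=
  fun u hu => (h u hu).2.continuousWithinAt

theorem exists_solution_mem_ball_or_exit [FiniteDimensional ℝ E] (hD : IsOpen D)
    (hX : ∀ z ∈ D, ContDiffAt ℝ 1 X z) {z₀ : E} (hz₀ : z₀ ∈ D) :
    ∃ R > 0, closedBall z₀ R ⊆ D ∧ ∀ ε ≤ R, ∀ z ∈ ball z₀ ε, ∃ γ : ℝ → E, γ 0 = z ∧
      ((IsSolutionOn X D γ (Ici 0) ∧ ∀ t, 0 ≤ t → γ t ∈ ball z₀ ε) ∨
        ∃ T, 0 ≤ T ∧ IsSolutionOn X D γ (Icc 0 T) ∧ dist (γ T) z₀ = ε) := by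
  have := FiniteDimensional.complete ℝ E
  obtain ⟨Y, R, hR, hRD, hYdiff, hYsupp, hYX⟩ :=
    exists_contDiff_hasCompactSupport_eqOn_closedBall hD hX hz₀
  refine ⟨R, hR, hRD, fun ε hε z hz => ?_⟩
  obtain ⟨γ, rfl, hγ⟩ := exists_forall_hasDerivAt_of_hasCompactSupport hYdiff hYsupp z
  have hγcont : Continuous γ := continuous_iff_continuousAt.2 fun t => (hγ t).continuousAt
  have hsol (s : Set ℝ) (hs : ∀ t ∈ s, γ t ∈ closedBall z₀ ε) : IsSolutionOn X D γ s := by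
    intro t ht
    have hmem := closedBall_subset_closedBall hε (hs t ht)
    exact ⟨hRD hmem, hYX hmem ▸ (hγ t).hasDerivWithinAt⟩
  refine ⟨γ, rfl, ?_⟩
  by_cases hstay : ∀ t, 0 ≤ t → γ t ∈ ball z₀ ε
  · exact .inl ⟨hsol _ fun t ht => ball_subset_closedBall (hstay t ht), hstay⟩
  · push Not at hstay
    obtain ⟨t, ht, hfar⟩ := hstay
    obtain ⟨T, hT, hTε, hle⟩ := exists_first_hitting_time
      (hγcont.dist (continuous_const (y := z₀))) hz ht (not_lt.1 hfar)
    exact .inr ⟨T, hT, hsol _ hle, hTε⟩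

/-- A first integral of `z' = X z` on `D`. Solutions are taken on compact intervals starting at time
`0`, in accordance with `IsLyapunovStable` and `IsLyapunovUnstableWithin`. -/
def IsFirstIntegral (X : E → E) (D : Set E) (F : E → ℝ) : Prop :=
  ∀ (γ : ℝ → E) (T : ℝ), 0 ≤ T → IsSolutionOn X D γ (Icc 0 T) → F (γ T) = F (γ 0)

theorem IsSolutionOn.hasDerivWithinAt_comp {γ : ℝ → E} {s : Set ℝ} (h : IsSolutionOn X D γ s)
    {F : E → ℝ} (hF : ∀ z ∈ D, DifferentiableAt ℝ F z) {t : ℝ} (ht : t ∈ s) :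
    HasDerivWithinAt (F ∘ γ) (fderiv ℝ F (γ t) (X (γ t))) s t :=
  (hF _ (h t ht).1).hasFDerivAt.comp_hasDerivWithinAt t (h t ht).2

theorem isFirstIntegral_of_fderiv_eq_zero {F : E → ℝ} (hF : ∀ z ∈ D, DifferentiableAt ℝ F z)
    (hFX : ∀ z ∈ D, fderiv ℝ F z (X z) = 0) : IsFirstIntegral X D F := fun γ T hT hγ =>
  constant_of_has_deriv_right_zero (f := F ∘ γ)
    (fun t ht => (hγ.hasDerivWithinAt_comp hF ht).continuousWithinAt)
    (fun t ht => by
      have hderiv := hγ.hasDerivWithinAt_comp hF (Ico_subset_Icc_self ht)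
      rw [hFX _ (hγ t (Ico_subset_Icc_self ht)).1] at hderiv
      exact hderiv.mono_of_mem_nhdsWithin (Icc_mem_nhdsGE_of_mem ht)) T (right_mem_Icc.2 hT)

theorem IsFirstIntegral.map₂ {F G : E → ℝ} (hF : IsFirstIntegral X D F)
    (hG : IsFirstIntegral X D G) (g : ℝ → ℝ → ℝ) :
    IsFirstIntegral X D (fun z => g (F z) (G z)) :=
  fun γ T hT hγ => congrArg₂ g (hF γ T hT hγ) (hG γ T hT hγ)

theorem IsFirstIntegral.dist_lt_of_lt_on_sphere {F : E → ℝ} (hF : IsFirstIntegral X D F)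
    {z₀ : E} {ρ T t : ℝ} {γ : ℝ → E} (hγ : IsSolutionOn X D γ (Icc 0 T))
    (hlt : ∀ w ∈ sphere z₀ ρ, F (γ 0) < F w) (h₀ : dist (γ 0) z₀ < ρ) (ht : t ∈ Icc 0 T) :
    dist (γ t) z₀ < ρ := by
  by_contra! hfar
  have hcont : ContinuousOn γ (Icc 0 t) := (hγ.mono (Icc_subset_Icc_right ht.2)).continuousOn
  obtain ⟨s, hs, hsρ⟩ := intermediate_value_Icc (f := fun s => dist (γ s) z₀) ht.1
    (by fun_prop) ⟨h₀.le, hfar⟩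
  exact (hlt (γ s) hsρ).ne' (hF γ s hs.1 (hγ.mono (Icc_subset_Icc_right (hs.2.trans ht.2))))

theorem exists_ball_lt_sphere {M : Type*} [PseudoMetricSpace M] [ProperSpace M] {F : M → ℝ}
    {z₀ : M} {ρ : ℝ} (hρ : 0 < ρ)
    (hF : ContinuousOn F (closedBall z₀ ρ)) (hlt : ∀ w ∈ sphere z₀ ρ, F z₀ < F w) :
    ∃ δ > 0, δ ≤ ρ ∧ ∀ z ∈ ball z₀ δ, ∀ w ∈ sphere z₀ ρ, F z < F w := by
  obtain hempty | hne := (sphere z₀ ρ).eq_empty_or_nonempty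
  · exact ⟨ρ, hρ, le_rfl, by simp [hempty]⟩
  obtain ⟨w₀, hw₀, hmin⟩ :=
    (isCompact_sphere z₀ ρ).exists_isMinOn hne (hF.mono sphere_subset_closedBall)
  obtain ⟨δ, hδ, hδF⟩ := nhds_basis_ball.mem_iff.1
    ((hF.continuousAt (closedBall_mem_nhds z₀ hρ)).eventually (gt_mem_nhds (hlt w₀ hw₀)))
  exact ⟨min δ ρ, lt_min hδ hρ, min_le_right _ _, fun z hz w hw =>
    (hδF (ball_subset_ball (min_le_left _ _) hz)).trans_le (hmin hw)⟩

theorem isLyapunovStable_of_firstIntegral [FiniteDimensional ℝ E] (hD : IsOpen D)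
    (hX : ∀ z ∈ D, ContDiffAt ℝ 1 X z) {z₀ : E} (hz₀ : z₀ ∈ D) (hX₀ : X z₀ = 0) {F : E → ℝ}
    (hFcont : ContinuousOn F D) (hF : IsFirstIntegral X D F)
    (hmin : ∀ᶠ z in 𝓝 z₀, z ≠ z₀ → F z₀ < F z) : IsLyapunovStable X D z₀ := by
  have := FiniteDimensional.proper ℝ E
  refine ⟨hz₀, hX₀, fun ε hε => ?_⟩
  obtain ⟨R, hR, hRD, hexit⟩ := exists_solution_mem_ball_or_exit hD hX hz₀
  obtain ⟨r, hr, hrF⟩ := nhds_basis_closedBall.mem_iff.1 hmin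
  obtain ⟨ρ, hρ, hρmin⟩ := exists_between (lt_min hε (lt_min hR hr))
  simp only [lt_min_iff] at hρmin
  obtain ⟨hρε, hρR, hρr⟩ := hρmin
  obtain ⟨δ, hδ, hδρ, hδF⟩ := exists_ball_lt_sphere hρ
    (hFcont.mono ((closedBall_subset_closedBall hρR.le).trans hRD)) fun w hw =>
      hrF (closedBall_subset_closedBall hρr.le (sphere_subset_closedBall hw))
        (ne_of_mem_sphere hw hρ.ne')
  refine ⟨δ, hδ, fun z _ hz => ⟨?_, ?_⟩⟩
  · obtain ⟨γ, rfl, ⟨hsol, -⟩ | ⟨T, hT, hsol, hdist⟩⟩ :=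
      hexit ρ hρR.le z (ball_subset_ball hδρ hz)
    · exact ⟨γ, rfl, hsol⟩
    · exact absurd (hF γ T hT hsol) (hδF _ hz _ hdist).ne'
  · rintro γ T - rfl hsol t ht
    exact (hF.dist_lt_of_lt_on_sphere hsol (hδF _ hz) (hz.trans_le hδρ) ht).trans hρε

theorem tendsto_atTop_of_mul_le_deriv {f f' : ℝ → ℝ} {c : ℝ} (hc : 0 < c)
    (hf : ∀ t, 0 ≤ t → HasDerivWithinAt f (f' t) (Ici 0) t) (h₀ : 0 < f 0)
    (hgrow : ∀ t, 0 ≤ t → 0 < f t → c * f t ≤ f' t) : Tendsto f atTop atTop := by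
  have hrate : 0 < c * f 0 / 2 := by positivity
  have hlow : ∀ t, 0 ≤ t → f 0 + c * f 0 / 2 * t ≤ f t := by
    intro T hT
    refine image_le_of_deriv_right_lt_deriv_boundary' (f := fun t => f 0 + c * f 0 / 2 * t)
      (f' := fun _ => c * f 0 / 2) (B := f) (B' := f') (a := 0) (b := T) (by fun_prop)
      (fun t _ => ?_) (by simp) (fun t ht => (hf t ht.1).continuousWithinAt.mono
        Icc_subset_Ici_self) (fun t ht => (hf t ht.1).mono (Ici_subset_Ici.2 ht.1))
      (fun t ht heq => ?_) (right_mem_Icc.2 hT)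
    · simpa using (((hasDerivAt_id t).const_mul (c * f 0 / 2)).const_add (f 0)).hasDerivWithinAt
    · have hle : f 0 ≤ f t := heq ▸ le_add_of_nonneg_right (mul_nonneg hrate.le ht.1)
      nlinarith [hgrow t ht.1 (h₀.trans_le hle)]
  refine tendsto_atTop_mono' atTop ((eventually_ge_atTop 0).mono hlow) ?_
  exact tendsto_atTop_add_const_left _ _ (tendsto_id.const_mul_atTop hrate)

theorem isLyapunovUnstableWithin_of_chetaev [FiniteDimensional ℝ E] {S A : Set E}
    (hD : IsOpen D) (hX : ∀ z ∈ D, ContDiffAt ℝ 1 X z) {z₀ : E} (hz₀ : z₀ ∈ D) (hX₀ : X z₀ = 0)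
    (hAS : A ⊆ S)
    (hinv : ∀ (γ : ℝ → E) (T : ℝ), 0 ≤ T → IsSolutionOn X D γ (Icc 0 T) → γ 0 ∈ A → γ T ∈ A)
    {V : E → ℝ} (hV : ∀ z ∈ D, DifferentiableAt ℝ V z) {c : ℝ} (hc : 0 < c)
    (hgrow : ∀ᶠ z in 𝓝 z₀, z ∈ A → 0 < V z → c * V z ≤ fderiv ℝ V z (X z))
    (hnear : ∃ᶠ z in 𝓝 z₀, z ∈ A ∧ 0 < V z) : IsLyapunovUnstableWithin X D S z₀ := by
  have := FiniteDimensional.proper ℝ E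
  obtain ⟨R, hR, hRD, hexit⟩ := exists_solution_mem_ball_or_exit hD hX hz₀
  obtain ⟨r, hr, hrV⟩ := nhds_basis_ball.mem_iff.1 hgrow
  have hε : 0 < min R r := lt_min hR hr
  refine ⟨hz₀, hX₀, min R r, hε, fun δ hδ => ?_⟩
  obtain ⟨z, ⟨hzA, hVz⟩, hz⟩ := (hnear.and_eventually (ball_mem_nhds z₀ (lt_min hε hδ))).exists
  obtain ⟨γ, rfl, ⟨hsol, hball⟩ | ⟨T, hT, hsol, hdist⟩⟩ :=
    hexit _ (min_le_left _ _) z (ball_subset_ball (min_le_left _ _) hz)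
  · have hA (t : ℝ) (ht : 0 ≤ t) : γ t ∈ A := hinv γ t ht (hsol.mono Icc_subset_Ici_self) hzA
    have hunbounded : Tendsto (V ∘ γ) atTop atTop := tendsto_atTop_of_mul_le_deriv hc
      (fun t ht => hsol.hasDerivWithinAt_comp hV ht) hVz fun t ht hpos =>
        hrV (ball_subset_ball (min_le_right _ _) (hball t ht)) (hA t ht) hpos
    obtain ⟨B, hB⟩ := (isCompact_closedBall z₀ R).exists_bound_of_continuousOn
      (fun w hw => (hV w (hRD hw)).continuousAt.continuousWithinAt)
    obtain ⟨t, hBt, ht⟩ :=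
      ((hunbounded.eventually_gt_atTop B).and (eventually_ge_atTop 0)).exists
    have hmem := closedBall_subset_closedBall (min_le_left R r)
      (ball_subset_closedBall (hball t ht))
    exact absurd (hB _ hmem) (not_le.2 (hBt.trans_le (le_abs_self _)))
  · exact ⟨γ, T, hT, hsol, hAS hzA, hz.trans_le (min_le_right _ _), hdist.ge⟩

end ODE

section EnergyCasimir

open Set Metric Filter Topology Asymptotics

variable {E : Type*} [NormedAddCommGroup E] [NormedSpace ℝ E]

theorem exists_pos_mul_sq_norm_le [FiniteDimensional ℝ E] {q : E → ℝ} (hq : Continuous q)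
    (hsmul : ∀ (t : ℝ) (v : E), q (t • v) = t ^ 2 * q v) (hpos : ∀ v, v ≠ 0 → 0 < q v) :
    ∃ m > 0, ∀ v, m * ‖v‖ ^ 2 ≤ q v := by
  have := FiniteDimensional.proper ℝ E
  have hq₀ : q 0 = 0 := by simpa using hsmul 0 0
  obtain hE | hE := subsingleton_or_nontrivial E
  · exact ⟨1, one_pos, fun v => by simp [Subsingleton.elim v 0, hq₀]⟩
  obtain ⟨u, hu, hmin⟩ := (isCompact_sphere (0 : E) 1).exists_isMinOn
    (NormedSpace.sphere_nonempty.2 zero_le_one) hq.continuousOn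
  refine ⟨q u, hpos u (ne_zero_of_mem_unit_sphere ⟨u, hu⟩), fun v => ?_⟩
  obtain rfl | hv := eq_or_ne v 0
  · simp [hq₀]
  calc q u * ‖v‖ ^ 2 ≤ q (‖v‖⁻¹ • v) * ‖v‖ ^ 2 := by
        gcongr
        exact hmin (by simp [norm_smul, inv_mul_cancel₀ (norm_ne_zero_iff.2 hv)])
    _ = q v := by rw [hsmul]; field_simp

/-- Finsler's lemma. -/
theorem exists_forall_pos_add_mul_sq [FiniteDimensional ℝ E] {q : E → ℝ} (hq : Continuous q)
    (hsmul : ∀ (t : ℝ) (v : E), q (t • v) = t ^ 2 * q v) (φ : E →L[ℝ] ℝ)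
    (hpos : ∀ v, φ v = 0 → v ≠ 0 → 0 < q v) : ∃ k, ∀ v, v ≠ 0 → 0 < q v + k * φ v ^ 2 := by
  have := FiniteDimensional.proper ℝ E
  suffices h : ∃ k, ∀ u ∈ sphere (0 : E) 1, 0 < q u + k * φ u ^ 2 by
    obtain ⟨k, hk⟩ := h
    refine ⟨k, fun v hv => ?_⟩
    have hscale : q v + k * φ v ^ 2 =
        ‖v‖ ^ 2 * (q (‖v‖⁻¹ • v) + k * φ (‖v‖⁻¹ • v) ^ 2) := by
      rw [hsmul, map_smul, smul_eq_mul]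
      field_simp
    rw [hscale]
    have := hk (‖v‖⁻¹ • v) (by simp [norm_smul, inv_mul_cancel₀ (norm_ne_zero_iff.2 hv)])
    positivity
  let T := sphere (0 : E) 1 ∩ {u | q u ≤ 0}
  have hT : IsCompact T := (isCompact_sphere 0 1).inter_right (isClosed_le hq continuous_const)
  obtain hempty | hne := T.eq_empty_or_nonempty
  · refine ⟨0, fun u hu => ?_⟩
    by_contra! hqu
    exact hempty.subset ⟨hu, by simpa using hqu⟩
  obtain ⟨B, hB⟩ := (isCompact_sphere (0 : E) 1).exists_bound_of_continuousOn hq.continuousOn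
  obtain ⟨w, hw, hmin⟩ := hT.exists_isMinOn hne
    (f := fun u => φ u ^ 2) (by fun_prop : Continuous fun u => φ u ^ 2).continuousOn
  have hφw : 0 < φ w ^ 2 := by
    refine sq_pos_of_ne_zero fun h => ?_
    exact (hpos w h (ne_zero_of_mem_unit_sphere ⟨w, hw.1⟩)).not_ge hw.2
  have hB₀ : 0 ≤ B := (norm_nonneg _).trans (hB w hw.1)
  refine ⟨(B + 1) / φ w ^ 2, fun u hu => ?_⟩
  obtain hqu | hqu := le_or_gt (q u) 0
  · have hle : φ w ^ 2 ≤ φ u ^ 2 := hmin ⟨hu, hqu⟩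
    have hk : B + 1 ≤ (B + 1) / φ w ^ 2 * φ u ^ 2 := by
      rw [div_mul_eq_mul_div, le_div_iff₀ hφw]
      gcongr
    linarith [(abs_le.1 (hB u hu)).1]
  · positivity

/-- `q` is the second variation of `F` at the critical point `z₀`: the homogeneous quadratic
function with `F z = F z₀ + q (z - z₀) + o(‖z - z₀‖²)`. -/
structure IsSecondVariation (F q : E → ℝ) (z₀ : E) : Prop where
  continuous : Continuous q
  homogeneous : ∀ (t : ℝ) (v : E), q (t • v) = t ^ 2 * q v
  isLittleO : (fun z => F z - F z₀ - q (z - z₀)) =o[𝓝 z₀] fun z => ‖z - z₀‖ ^ 2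

namespace IsSecondVariation

variable {F q : E → ℝ} {z₀ : E}

theorem sub_of_homogeneous (hq : Continuous q)
    (hsmul : ∀ (t : ℝ) (v : E), q (t • v) = t ^ 2 * q v) :
    IsSecondVariation (fun z => q (z - z₀)) q z₀ where
  continuous := hq
  homogeneous := hsmul
  isLittleO := by
    have hq₀ : q 0 = 0 := by simpa using hsmul 0 0
    simp [hq₀]

theorem add_mul_sq (h : IsSecondVariation F q z₀) {C : E → ℝ} {C' : E →L[ℝ] ℝ}
    (hC : HasFDerivAt C C' z₀) (k : ℝ) :
    IsSecondVariation (fun z => F z + k * (C z - C z₀) ^ 2) (fun v => q v + k * C' v ^ 2) z₀ where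
  continuous := h.continuous.add (by fun_prop)
  homogeneous t v := by rw [h.homogeneous, C'.map_smul, smul_eq_mul]; ring
  isLittleO := by
    have hO : (fun z => C z - C z₀ + C' (z - z₀)) =O[𝓝 z₀] fun z => ‖z - z₀‖ :=
      (hC.isBigO_sub.add (C'.isBigO_sub _ z₀)).norm_right
    have hprod := (hC.isLittleO.norm_right.mul_isBigO hO).const_mul_left k
    refine (h.isLittleO.add (hprod.congr_right fun z => (sq _).symm)).congr_left fun z => ?_
    ring

theorem exists_mul_sq_norm_le [FiniteDimensional ℝ E] (h : IsSecondVariation F q z₀)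
    (hpos : ∀ v, v ≠ 0 → 0 < q v) :
    ∃ m > 0, ∀ᶠ z in 𝓝 z₀, m * ‖z - z₀‖ ^ 2 ≤ F z - F z₀ := by
  obtain ⟨m, hm, hle⟩ := exists_pos_mul_sq_norm_le h.continuous h.homogeneous hpos
  refine ⟨m / 2, half_pos hm, (h.isLittleO.def (half_pos hm)).mono fun z hz => ?_⟩
  rw [Real.norm_eq_abs, norm_pow, norm_norm] at hz
  linarith [(abs_le.1 hz).1, hle (z - z₀)]

theorem tendsto_along_curve (h : IsSecondVariation F q z₀) {ζ : ℝ → E} {v : E}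
    (hζ : HasDerivAt ζ v 0) (hζ₀ : ζ 0 = z₀) :
    Tendsto (fun s => (s ^ 2)⁻¹ * (F (ζ s) - F z₀)) (𝓝[≠] 0) (𝓝 (q v)) := by
  subst hζ₀
  have hquad : Tendsto (fun s => (s ^ 2)⁻¹ * q (ζ s - ζ 0)) (𝓝[≠] 0) (𝓝 (q v)) := by
    refine ((h.continuous.tendsto v).comp hζ.tendsto_slope_zero).congr fun s => ?_
    simp [h.homogeneous]
  have hrem : Tendsto (fun s => (s ^ 2)⁻¹ * (F (ζ s) - F (ζ 0) - q (ζ s - ζ 0))) (𝓝[≠] 0)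
      (𝓝 0) := by
    have hO : (fun s => ‖ζ s - ζ 0‖ ^ 2) =O[𝓝 0] fun s : ℝ => s ^ 2 := by
      simpa using (hζ.isBigO_sub.norm_left.pow 2)
    have ho := ((h.isLittleO.comp_tendsto hζ.continuousAt).trans_isBigO hO).mono
      (nhdsWithin_le_nhds (s := {0}ᶜ))
    simpa only [div_eq_inv_mul, Function.comp_apply] using ho.tendsto_div_nhds_zero
  simpa [← mul_add] using hquad.add hrem

end IsSecondVariation

theorem exists_curve_in_level_set [CompleteSpace E] {G : Type*} [NormedAddCommGroup G]
    [NormedSpace ℝ G] [FiniteDimensional ℝ G] {C : E → G} {C' : E →L[ℝ] G} {z₀ v : E}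
    (hC : HasStrictFDerivAt C C' z₀) (hsurj : C'.range = ⊤) (hv : C' v = 0) :
    ∃ ζ : ℝ → E, ζ 0 = z₀ ∧ HasDerivAt ζ v 0 ∧ ∀ᶠ s in 𝓝 0, C (ζ s) = C z₀ := by
  let w : C'.ker := ⟨v, hv⟩
  have hline : HasDerivAt (fun s : ℝ => s • w) w 0 := by
    simpa using (hasDerivAt_id (0 : ℝ)).smul_const w
  refine ⟨fun s => hC.implicitFunction C C' hsurj (C z₀) (s • w), by simp, ?_, ?_⟩
  · exact (hC.to_implicitFunction hsurj).hasFDerivAt.comp_hasDerivAt_of_eq 0 hline (by simp)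
  · have htendsto : Tendsto (fun s : ℝ => (C z₀, s • w)) (𝓝 0) (𝓝 (C z₀, 0)) :=
      tendsto_const_nhds.prodMk_nhds (by simpa using hline.continuousAt.tendsto)
    exact htendsto.eventually (hC.map_implicitFunction_eq hsurj)

variable {X : E → E} {D : Set E} {F C q : E → ℝ} {C' : E →L[ℝ] ℝ} {z₀ : E}

theorem isLittleO_apply_sub_of_comp_eq {A : E →L[ℝ] E} (hA : HasFDerivAt X A z₀) (hX₀ : X z₀ = 0)
    (hC' : HasFDerivAt C C' z₀) {φ ψ : E →L[ℝ] ℝ} {l a : ℝ} (hφ : φ ∘L A = l • ψ + a • C') :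
    (fun z => φ (X z) - l * ψ (z - z₀)) =o[𝓝[{z | C z = C z₀}] z₀] fun z => z - z₀ := by
  have hXo : (fun z => φ (X z - A (z - z₀))) =o[𝓝 z₀] fun z => z - z₀ := by
    refine (φ.isBigO_comp _ _).trans_isLittleO ?_
    simpa [hX₀] using hA.isLittleO
  have hCo : (fun z => a * C' (z - z₀)) =o[𝓝[{z | C z = C z₀}] z₀] fun z => z - z₀ := by
    refine ((hC'.isLittleO.mono nhdsWithin_le_nhds).neg_left.congr' ?_ .rfl).const_mul_left a
    filter_upwards [self_mem_nhdsWithin] with z hz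
    simp [show C z = C z₀ from hz]
  refine ((hXo.mono nhdsWithin_le_nhds).add hCo).congr_left fun z => ?_
  have := congrArg (· (z - z₀)) hφ
  simp only [ContinuousLinearMap.comp_apply, add_apply, smul_apply, smul_eq_mul] at this
  rw [map_sub, this]
  ring

theorem eventually_mul_le_deriv_mul {S : Set E} {φ ψ : E →L[ℝ] ℝ} {l B : ℝ} (hl : 0 < l)
    (hB : 0 < B) (hφ : (fun z => φ (X z) - l * ψ (z - z₀)) =o[𝓝[S] z₀] fun z => z - z₀)
    (hψ : (fun z => ψ (X z) - l * φ (z - z₀)) =o[𝓝[S] z₀] fun z => z - z₀)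
    (hle : ∀ᶠ z in 𝓝[S] z₀, ‖z - z₀‖ ^ 2 ≤ B * φ (z - z₀) ^ 2) :
    ∀ᶠ z in 𝓝[S] z₀, l * (φ (z - z₀) * ψ (z - z₀)) ≤
      φ (z - z₀) * ψ (X z) + ψ (z - z₀) * φ (X z) := by
  have hrem : (fun z => φ (z - z₀) * (ψ (X z) - l * φ (z - z₀)) +
      ψ (z - z₀) * (φ (X z) - l * ψ (z - z₀))) =o[𝓝[S] z₀] fun z => ‖z - z₀‖ ^ 2 := by
    refine (((φ.isBigO_sub _ z₀).norm_right.mul_isLittleO hψ.norm_right).add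
      ((ψ.isBigO_sub _ z₀).norm_right.mul_isLittleO hφ.norm_right)).congr_right fun z => ?_
    exact (sq _).symm
  filter_upwards [hrem.def (show 0 < l / (2 * B) by positivity), hle] with z hz hzB
  rw [norm_pow, norm_norm, Real.norm_eq_abs] at hz
  have hsmall : l / (2 * B) * ‖z - z₀‖ ^ 2 ≤ l / 2 * φ (z - z₀) ^ 2 :=
    calc l / (2 * B) * ‖z - z₀‖ ^ 2 ≤ l / (2 * B) * (B * φ (z - z₀) ^ 2) := by gcongr
      _ = l / 2 * φ (z - z₀) ^ 2 := by field_simp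
  nlinarith [(abs_le.1 hz).1, mul_nonneg hl.le (sq_nonneg (φ (z - z₀) - ψ (z - z₀))),
    mul_nonneg hl.le (sq_nonneg (ψ (z - z₀)))]

variable [FiniteDimensional ℝ E]

/-- The **energy–Casimir method**. -/
theorem isLyapunovStable_of_secondVariation_pos (hD : IsOpen D)
    (hX : ∀ z ∈ D, ContDiffAt ℝ 1 X z) (hz₀ : z₀ ∈ D) (hX₀ : X z₀ = 0)
    (hFcont : ContinuousOn F D) (hF : IsFirstIntegral X D F) (hCcont : ContinuousOn C D)
    (hC : IsFirstIntegral X D C) (hFq : IsSecondVariation F q z₀) (hC' : HasFDerivAt C C' z₀)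
    (hpos : ∀ v, C' v = 0 → v ≠ 0 → 0 < q v) : IsLyapunovStable X D z₀ := by
  obtain ⟨k, hk⟩ := exists_forall_pos_add_mul_sq hFq.continuous hFq.homogeneous C' hpos
  obtain ⟨m, hm, hle⟩ := (hFq.add_mul_sq hC' k).exists_mul_sq_norm_le hk
  refine isLyapunovStable_of_firstIntegral hD hX hz₀ hX₀
    (F := fun z => F z + k * (C z - C z₀) ^ 2) (by fun_prop)
    (hF.map₂ hC fun a b => a + k * (b - C z₀) ^ 2) (hle.mono fun z hz hne => sub_pos.1 ?_)
  have : 0 < ‖z - z₀‖ := norm_sub_pos_iff.2 hne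
  exact (by positivity : 0 < m * ‖z - z₀‖ ^ 2).trans_le hz

theorem exists_sq_norm_le_mul_sq_of_sublevel (hFq : IsSecondVariation F q z₀)
    (hC' : HasFDerivAt C C' z₀) {φ : E →L[ℝ] ℝ} {k : ℝ}
    (hpos : ∀ v, C' v = 0 → v ≠ 0 → 0 < q v + k * φ v ^ 2) :
    ∃ B > 0, ∀ᶠ z in 𝓝 z₀, C z = C z₀ → F z ≤ F z₀ → ‖z - z₀‖ ^ 2 ≤ B * φ (z - z₀) ^ 2 := by
  have hFk := hFq.add_mul_sq φ.hasFDerivAt k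
  obtain ⟨K, hK⟩ := exists_forall_pos_add_mul_sq hFk.continuous hFk.homogeneous C' hpos
  obtain ⟨m, hm, hle⟩ := (hFk.add_mul_sq hC' K).exists_mul_sq_norm_le hK
  refine ⟨(|k| + 1) / m, by positivity, hle.mono fun z hz hCz hFz => ?_⟩
  rw [div_mul_eq_mul_div, le_div_iff₀ hm]
  have hφk : k * φ (z - z₀) ^ 2 ≤ (|k| + 1) * φ (z - z₀) ^ 2 := by
    gcongr
    linarith [le_abs_self k]
  simp only [hCz, ← map_sub, sub_self] at hz
  linarith

theorem frequently_of_secondVariation_neg {φ ψ : E →L[ℝ] ℝ} (hFq : IsSecondVariation F q z₀)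
    (hC' : HasStrictFDerivAt C C' z₀) (hsurj : C'.range = ⊤) {v : E} (hv : C' v = 0)
    (hqv : q v < 0) (hφψ : 0 < φ v * ψ v) :
    ∃ᶠ z in 𝓝 z₀, (C z = C z₀ ∧ F z ≤ F z₀) ∧ 0 < φ (z - z₀) * ψ (z - z₀) := by
  have := FiniteDimensional.complete ℝ E
  obtain ⟨ζ, hζ₀, hζ, hCζ⟩ := exists_curve_in_level_set hC' hsurj hv
  have hV : IsSecondVariation (fun z => φ (z - z₀) * ψ (z - z₀)) (fun v => φ v * ψ v) z₀ :=
    .sub_of_homogeneous (q := fun v => φ v * ψ v) (by fun_prop) fun t v => by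
      simp only [map_smul, smul_eq_mul]; ring
  have hζtendsto : Tendsto ζ (𝓝[≠] 0) (𝓝 z₀) :=
    hζ₀ ▸ hζ.continuousAt.tendsto.mono_left nhdsWithin_le_nhds
  refine hζtendsto.frequently (Eventually.frequently ?_)
  filter_upwards [(hFq.tendsto_along_curve hζ hζ₀).eventually_lt_const hqv,
    (hV.tendsto_along_curve hζ hζ₀).eventually_const_lt hφψ, hCζ.filter_mono nhdsWithin_le_nhds,
    self_mem_nhdsWithin] with s hFs hVs hCs (hs : s ≠ 0)
  have hs2 : 0 < (s ^ 2)⁻¹ := by positivity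
  refine ⟨⟨hCs, ?_⟩, ?_⟩
  · exact (sub_neg.1 (neg_of_mul_neg_right hFs hs2.le)).le
  · simpa using (pos_iff_pos_of_mul_pos hVs).1 hs2

/-- If the second variation is indefinite on the kernel of `C'`, with negative index one in the
direction of `φ`, then `φ ψ` is a Chetaev function in the region `F ≤ F z₀` of the level set of `C`,
because there `z - z₀` is controlled by `φ (z - z₀)`. -/
theorem isLyapunovUnstableWithin_of_hyperbolic_pair (hD : IsOpen D)
    (hX : ∀ z ∈ D, ContDiffAt ℝ 1 X z) (hz₀ : z₀ ∈ D) (hX₀ : X z₀ = 0)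
    (hF : IsFirstIntegral X D F) (hC : IsFirstIntegral X D C) (hFq : IsSecondVariation F q z₀)
    (hC' : HasStrictFDerivAt C C' z₀) (hsurj : C'.range = ⊤) {A : E →L[ℝ] E}
    (hA : HasFDerivAt X A z₀) {φ ψ : E →L[ℝ] ℝ} {l a b k : ℝ} (hl : 0 < l)
    (hφ : φ ∘L A = l • ψ + a • C') (hψ : ψ ∘L A = l • φ + b • C')
    (hpos : ∀ v, C' v = 0 → v ≠ 0 → 0 < q v + k * φ v ^ 2) {v : E} (hv : C' v = 0)
    (hqv : q v < 0) (hφψ : 0 < φ v * ψ v) :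
    IsLyapunovUnstableWithin X D {z | C z = C z₀} z₀ := by
  obtain ⟨B, hB, hle⟩ := exists_sq_norm_le_mul_sq_of_sublevel hFq hC'.hasFDerivAt hpos
  let S := {z | C z = C z₀ ∧ F z ≤ F z₀}
  have hSC : 𝓝[S] z₀ ≤ 𝓝[{z | C z = C z₀}] z₀ := nhdsWithin_mono _ fun z hz => hz.1
  have hgrow := eventually_mul_le_deriv_mul hl hB
    ((isLittleO_apply_sub_of_comp_eq hA hX₀ hC'.hasFDerivAt hφ).mono hSC)
    ((isLittleO_apply_sub_of_comp_eq hA hX₀ hC'.hasFDerivAt hψ).mono hSC)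
    (eventually_nhdsWithin_iff.2 (hle.mono fun z hz hzS => hz hzS.1 hzS.2))
  have hV (z : E) : HasFDerivAt (fun z => φ (z - z₀) * ψ (z - z₀))
      (φ (z - z₀) • ψ + ψ (z - z₀) • φ) z :=
    (φ.hasFDerivAt.comp z (hasFDerivAt_sub_const z₀)).mul
      (ψ.hasFDerivAt.comp z (hasFDerivAt_sub_const z₀))
  refine isLyapunovUnstableWithin_of_chetaev (A := S) hD hX hz₀ hX₀ (fun z hz => hz.1)
    (fun γ T hT hγ h₀ => ⟨(hC γ T hT hγ).trans h₀.1, (hF γ T hT hγ).trans_le h₀.2⟩)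
    (fun z _ => (hV z).differentiableAt) hl ?_
    (frequently_of_secondVariation_neg hFq hC' hsurj hv hqv hφψ)
  filter_upwards [eventually_nhdsWithin_iff.1 hgrow] with z hz hzS _
  rw [(hV z).fderiv]
  exact hz hzS

end EnergyCasimir

section ReducedSystem

/-- The hyperbolic cotangent. -/
def coth (q : ℝ) : ℝ := Real.cosh q / Real.sinh q

theorem one_lt_coth {q : ℝ} (hq : 0 < q) : 1 < coth q := by
  rw [coth, one_lt_div (Real.sinh_pos_iff.2 hq)]
  exact Real.sinh_lt_cosh q

theorem coth_sq_sub_one {q : ℝ} (hq : q ≠ 0) : coth q ^ 2 - 1 = (Real.sinh q ^ 2)⁻¹ := by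
  have hs : Real.sinh q ≠ 0 := Real.sinh_ne_zero.2 hq
  rw [coth, div_pow, Real.cosh_sq]
  field_simp
  ring

theorem hasDerivAt_coth {q : ℝ} (hq : 0 < q) : HasDerivAt coth (-(coth q ^ 2 - 1)) q := by
  have hs : Real.sinh q ≠ 0 := (Real.sinh_pos_iff.2 hq).ne'
  refine ((Real.hasDerivAt_cosh q).div (Real.hasDerivAt_sinh q) hs).congr_deriv ?_
  rw [coth]
  field_simp
  ring

theorem contDiffAt_coth {n : WithTop ℕ∞} {q : ℝ} (hq : 0 < q) : ContDiffAt ℝ n coth q :=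
  Real.contDiff_cosh.contDiffAt.div Real.contDiff_sinh.contDiffAt (Real.sinh_pos_iff.2 hq).ne'

theorem isOpen_redSpace : IsOpen redSpace :=
  isOpen_lt continuous_const (continuous_fst.comp continuous_snd)

theorem contDiffAt_coth_coordinate {n : WithTop ℕ∞} {z : RedVec} (hz : z ∈ redSpace) :
    ContDiffAt ℝ n (fun w : RedVec => coth w.2.1) z :=
  ContDiffAt.comp z (contDiffAt_coth hz) (contDiffAt_fst.comp z contDiffAt_snd)

theorem gravPotential_eq (G μ₁ μ₂ q : ℝ) :
    gravPotential G μ₁ μ₂ q = -(G * μ₁ * μ₂) * coth q := by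
  rw [gravPotential, Real.tanh_eq_sinh_div_cosh, coth, div_div_eq_mul_div, mul_div_assoc]

theorem mink_eq (x y : Vec) : mink x y = x 0 * y 0 + x 1 * y 1 - x 2 * y 2 := by
  simp only [mink, K, Matrix.mulVec_diagonal, dotProduct, Fin.sum_univ_three, Matrix.cons_val]
  ring

/-- The reduced Hamiltonian of `m = (x, y, z)` and `p`, multiplied by `μ₁` and expressed through
`c = coth q`, for `M = 1 + μ₁ / μ₂` and `g = G μ₁² μ₂`. -/
def energy (M g x y z c p : ℝ) : ℝ :=
  1 / 2 * (x ^ 2 + y ^ 2 - 2 * c * y * z + (M * (c ^ 2 - 1) + 1) * z ^ 2 - 2 * x * p + M * p ^ 2)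
    - g * c

/-- The reduced Hamiltonian multiplied by `μ₁`, for `M = 1 + μ₁ / μ₂` and `g = G μ₁² μ₂`. -/
def scaledHamiltonian (M g : ℝ) (z : RedVec) : ℝ :=
  energy M g (z.1 0) (z.1 1) (z.1 2) (coth z.2.1) z.2.2

/-- The reduced vector field multiplied by `μ₁`, for `M = 1 + μ₁ / μ₂` and `g = G μ₁² μ₂`. -/
def scaledField (M g : ℝ) : RedVec → RedVec := fun ⟨m, q, p⟩ =>
  (![-coth q * (m 1 ^ 2 + m 2 ^ 2) + (M * (coth q ^ 2 - 1) + 2) * m 1 * m 2,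
     m 2 * p - (M * (coth q ^ 2 - 1) + 2) * m 0 * m 2 + coth q * m 0 * m 1,
     m 1 * p - coth q * m 0 * m 2],
   M * p - m 0,
   (coth q ^ 2 - 1) * (M * coth q * m 2 ^ 2 - m 1 * m 2 - g))

theorem hamiltonian_eq (G : ℝ) {μ₁ μ₂ : ℝ} (hμ₁ : μ₁ ≠ 0) {z : RedVec} (hz : z ∈ redSpace) :
    hamiltonian μ₁ μ₂ (gravPotential G μ₁ μ₂) z.1 z.2.1 z.2.2 =
      1 / μ₁ * scaledHamiltonian (1 + μ₁ / μ₂) (G * μ₁ ^ 2 * μ₂) z := by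
  have hq : z.2.1 ≠ 0 := ne_of_gt hz
  have hs : Real.sinh z.2.1 ≠ 0 := Real.sinh_ne_zero.2 hq
  have hA : (μ₁ / μ₂ + Real.cosh z.2.1 ^ 2) / Real.sinh z.2.1 ^ 2 =
      (1 + μ₁ / μ₂) * (coth z.2.1 ^ 2 - 1) + 1 := by
    rw [coth_sq_sub_one hq, Real.cosh_sq]
    generalize μ₁ / μ₂ = μ
    field_simp
    ring
  rw [hamiltonian, gravPotential_eq, inertia, hA, scaledHamiltonian, energy, ← coth]
  simp only [dotProduct, Matrix.mulVec, Fin.sum_univ_three, Matrix.of_apply, Matrix.cons_val]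
  generalize μ₁ / μ₂ = μ
  field_simp
  ring

theorem contDiffAt_scaledHamiltonian (M g : ℝ) {n : WithTop ℕ∞} {z : RedVec}
    (hz : z ∈ redSpace) : ContDiffAt ℝ n (scaledHamiltonian M g) z := by
  have hc := contDiffAt_coth_coordinate (n := n) hz
  unfold scaledHamiltonian energy
  fun_prop

theorem contDiffAt_scaledField (M g : ℝ) {n : WithTop ℕ∞} {z : RedVec} (hz : z ∈ redSpace) :
    ContDiffAt ℝ n (scaledField M g) z := by
  have hc := contDiffAt_coth_coordinate (n := n) hz
  unfold scaledField
  refine ContDiffAt.prodMk (contDiffAt_pi.2 fun i => ?_) (ContDiffAt.prodMk ?_ ?_)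
  · fin_cases i <;> simp only [Fin.mk_one, Fin.zero_eta, Fin.reduceFinMk, Matrix.cons_val] <;>
      fun_prop
  · fun_prop
  · fun_prop

theorem hasDerivAt_line (a b : ℝ) : HasDerivAt (fun t : ℝ => a + t * b) b 0 := by
  simpa using ((hasDerivAt_id (0 : ℝ)).mul_const b).const_add a

theorem hasDerivAt_coth_line {z : RedVec} (hz : z ∈ redSpace) (v : RedVec) :
    HasDerivAt (fun t : ℝ => coth (z.2.1 + t * v.2.1)) (-(coth z.2.1 ^ 2 - 1) * v.2.1) 0 := by
  refine HasDerivAt.comp (h₂ := coth) 0 ?_ (hasDerivAt_line z.2.1 v.2.1)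
  rw [zero_mul, add_zero]
  exact hasDerivAt_coth hz

theorem fderiv_scaledHamiltonian (M g : ℝ) {z : RedVec} (hz : z ∈ redSpace) (v : RedVec) :
    fderiv ℝ (scaledHamiltonian M g) z v =
      (z.1 0 - z.2.2) * v.1 0 + (z.1 1 - coth z.2.1 * z.1 2) * v.1 1
        + ((M * (coth z.2.1 ^ 2 - 1) + 1) * z.1 2 - coth z.2.1 * z.1 1) * v.1 2
        - (coth z.2.1 ^ 2 - 1) * (M * coth z.2.1 * z.1 2 ^ 2 - z.1 1 * z.1 2 - g) * v.2.1
        + (M * z.2.2 - z.1 0) * v.2.2 := by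
  rw [← ((contDiffAt_scaledHamiltonian M g (n := 1) hz).differentiableAt
    one_ne_zero).lineDeriv_eq_fderiv]
  have hc := hasDerivAt_coth_line hz v
  have hx := hasDerivAt_line (z.1 0) (v.1 0)
  have hy := hasDerivAt_line (z.1 1) (v.1 1)
  have hm := hasDerivAt_line (z.1 2) (v.1 2)
  have hp := hasDerivAt_line z.2.2 v.2.2
  have hF : HasLineDerivAt ℝ (scaledHamiltonian M g) _ z v :=
    ((((((hx.pow 2).add (hy.pow 2)).sub (((hc.const_mul 2).mul hy).mul hm)).add
      (((((hc.pow 2).sub_const 1).const_mul M).add_const 1).mul (hm.pow 2))).sub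
      ((hx.const_mul 2).mul hp)).add ((hp.pow 2).const_mul M)).const_mul (1 / 2) |>.sub
      (hc.const_mul g)
  rw [hF.lineDeriv]
  simp only [zero_mul, add_zero, Pi.pow_apply, Pi.mul_apply]
  ring

theorem redField_eq_of_hasFDerivAt {μ₁ μ₂ : ℝ} {U : ℝ → ℝ} {z : RedVec} {H' : RedVec →L[ℝ] ℝ}
    (hH : HasFDerivAt (fun w : RedVec => hamiltonian μ₁ μ₂ U w.1 w.2.1 w.2.2) H' z) :
    redField μ₁ μ₂ U z =
      ((K *ᵥ z.1) ⨯₃ (fun i => H' (Pi.single i 1, 0, 0)), H' (0, 0, 1), -H' (0, 1, 0)) := by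
  have hm : HasFDerivAt (fun m => hamiltonian μ₁ μ₂ U m z.2.1 z.2.2)
      (H' ∘L ContinuousLinearMap.inl ℝ Vec (ℝ × ℝ)) z.1 :=
    HasFDerivAt.comp (f := fun m => (m, z.2)) z.1 hH (hasFDerivAt_prodMk_left z.1 z.2)
  have hq : HasDerivAt (fun q => hamiltonian μ₁ μ₂ U z.1 q z.2.2) (H' (0, 1, 0)) z.2.1 :=
    HasFDerivAt.comp_hasDerivAt (f := fun q => (z.1, q, z.2.2)) z.2.1 hH
      ((hasDerivAt_const _ z.1).prodMk ((hasDerivAt_id z.2.1).prodMk (hasDerivAt_const _ z.2.2)))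
  have hp : HasDerivAt (fun p => hamiltonian μ₁ μ₂ U z.1 z.2.1 p) (H' (0, 0, 1)) z.2.2 :=
    HasFDerivAt.comp_hasDerivAt (f := fun p => (z.1, z.2.1, p)) z.2.2 hH
      ((hasDerivAt_const _ z.1).prodMk ((hasDerivAt_const _ z.2.1).prodMk (hasDerivAt_id z.2.2)))
  rw [redField, hm.fderiv, hq.deriv, hp.deriv]
  rfl

theorem redField_eq_smul (G : ℝ) {μ₁ μ₂ : ℝ} (hμ₁ : μ₁ ≠ 0) {z : RedVec} (hz : z ∈ redSpace) :
    redField μ₁ μ₂ (gravPotential G μ₁ μ₂) z =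
      (1 / μ₁) • scaledField (1 + μ₁ / μ₂) (G * μ₁ ^ 2 * μ₂) z := by
  have hdiff := (contDiffAt_scaledHamiltonian (1 + μ₁ / μ₂) (G * μ₁ ^ 2 * μ₂) (n := 1) hz)
    |>.differentiableAt one_ne_zero
  rw [redField_eq_of_hasFDerivAt ((hdiff.hasFDerivAt.const_mul (1 / μ₁)).congr_of_eventuallyEq <| by
    filter_upwards [isOpen_redSpace.mem_nhds hz] with w hw using hamiltonian_eq G hμ₁ hw)]
  simp only [smul_apply, fderiv_scaledHamiltonian _ _ hz, smul_eq_mul]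
  refine Prod.ext (funext fun i => ?_) (Prod.ext ?_ ?_)
  · fin_cases i <;>
      simp [scaledField, K, Matrix.mulVec_diagonal, cross_apply, -mul_eq_mul_left_iff] <;> ring
  all_goals simp [scaledField]

theorem contDiffAt_redField (G : ℝ) {μ₁ μ₂ : ℝ} (hμ₁ : μ₁ ≠ 0) {n : WithTop ℕ∞} {z : RedVec}
    (hz : z ∈ redSpace) : ContDiffAt ℝ n (redField μ₁ μ₂ (gravPotential G μ₁ μ₂)) z :=
  ((contDiffAt_scaledField _ _ hz).const_smul (1 / μ₁)).congr_of_eventuallyEq <| by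
    filter_upwards [isOpen_redSpace.mem_nhds hz] with w hw using redField_eq_smul G hμ₁ hw

theorem contDiff_casimir {n : WithTop ℕ∞} : ContDiff ℝ n casimir := by
  unfold casimir
  simp only [mink_eq]
  fun_prop

theorem fderiv_casimir (z v : RedVec) : fderiv ℝ casimir z v = -2 * mink z.1 v.1 := by
  rw [← ((contDiff_casimir (n := 1)).differentiable one_ne_zero z).lineDeriv_eq_fderiv]
  have hx := (hasDerivAt_line (z.1 0) (v.1 0)).pow 2
  have hy := (hasDerivAt_line (z.1 1) (v.1 1)).pow 2
  have hm := (hasDerivAt_line (z.1 2) (v.1 2)).pow 2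
  have hC : HasLineDerivAt ℝ casimir _ z v := (((hx.add hy).sub hm).neg).congr_of_eventuallyEq <|
    .of_forall fun t => by
      simp only [casimir, mink_eq, Prod.fst_add, Prod.smul_fst, Pi.add_apply, Pi.smul_apply,
        smul_eq_mul, Pi.neg_apply, Pi.sub_apply, Pi.pow_apply]
      ring
  rw [hC.lineDeriv, mink_eq]
  simp only [zero_mul, add_zero]
  ring

theorem isFirstIntegral_casimir (μ₁ μ₂ : ℝ) (U : ℝ → ℝ) (D : Set RedVec) :
    IsFirstIntegral (redField μ₁ μ₂ U) D casimir :=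
  isFirstIntegral_of_fderiv_eq_zero
    (fun z _ => (contDiff_casimir (n := 1)).differentiable one_ne_zero z) fun z _ => by
      rw [fderiv_casimir, mink, redField, Matrix.dotProduct_mulVec, ← Matrix.mulVec_transpose, K,
        Matrix.diagonal_transpose, dot_self_cross, mul_zero]

theorem isFirstIntegral_scaledHamiltonian (G : ℝ) {μ₁ μ₂ : ℝ} (hμ₁ : μ₁ ≠ 0) :
    IsFirstIntegral (redField μ₁ μ₂ (gravPotential G μ₁ μ₂)) redSpace
      (scaledHamiltonian (1 + μ₁ / μ₂) (G * μ₁ ^ 2 * μ₂)) :=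
  isFirstIntegral_of_fderiv_eq_zero
    (fun z hz => (contDiffAt_scaledHamiltonian _ _ (n := 1) hz).differentiableAt one_ne_zero)
    fun z hz => by
      rw [redField_eq_smul G hμ₁ hz, map_smul, fderiv_scaledHamiltonian _ _ hz]
      simp only [scaledField, Matrix.cons_val, smul_eq_mul]
      ring

end ReducedSystem

section QuadraticForms

theorem binaryForm_pos {α β γ : ℝ} (hα : 0 < α) (h : β ^ 2 < α * γ) {a b : ℝ}
    (hab : a ≠ 0 ∨ b ≠ 0) : 0 < α * a ^ 2 + 2 * β * a * b + γ * b ^ 2 := by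
  have hsq : α * (α * a ^ 2 + 2 * β * a * b + γ * b ^ 2) =
      (α * a + β * b) ^ 2 + (α * γ - β ^ 2) * b ^ 2 := by ring
  refine pos_of_mul_pos_right (hsq ▸ ?_) hα.le
  have : 0 < α * γ - β ^ 2 := sub_pos.2 h
  rcases eq_or_ne b 0 with rfl | hb
  · have ha : a ≠ 0 := hab.resolve_right (· rfl)
    simp only [mul_zero, add_zero, ne_eq, OfNat.ofNat_ne_zero, not_false_eq_true, zero_pow]
    positivity
  · positivity

theorem binaryForm_nonneg {α β γ : ℝ} (hα : 0 < α) (h : β ^ 2 < α * γ) (a b : ℝ) :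
    0 ≤ α * a ^ 2 + 2 * β * a * b + γ * b ^ 2 := by
  by_cases hab : a ≠ 0 ∨ b ≠ 0
  · exact (binaryForm_pos hα h hab).le
  · obtain ⟨rfl, rfl⟩ := not_or.1 hab |>.imp not_not.1 not_not.1
    simp

theorem exists_pos_root_of_neg {a b c : ℝ} (ha : 0 < a) (hc : c < 0) :
    ∃ x, 0 < x ∧ a * x ^ 2 + b * x + c = 0 := by
  have hac : a * c < 0 := mul_neg_of_pos_of_neg ha hc
  have hw : √(b ^ 2 - 4 * (a * c)) ^ 2 = b ^ 2 - 4 * (a * c) :=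
    Real.sq_sqrt (by nlinarith [sq_nonneg b])
  have hbw : b < √(b ^ 2 - 4 * (a * c)) := Real.lt_sqrt_of_sq_lt (by linarith)
  refine ⟨(√(b ^ 2 - 4 * (a * c)) - b) / (2 * a), div_pos (sub_pos.2 hbw) (by positivity), ?_⟩
  generalize √(b ^ 2 - 4 * (a * c)) = w at hw
  field_simp
  linear_combination hw

/-- The vector `(o, e) = (a, b)` spans an eigenline, with eigenvalue `l > 0`, of the linear
Hamiltonian system `e' = -T o`, `o' = S e` with the symmetric matrices `T = (k, -1; -1, M)` and `S`,
and the quadratic form `(e, S e)` is negative at `e = b`. -/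
structure IsHyperbolicMode (k M S₁₁ S₁₂ S₂₂ l a₁ a₂ b₁ b₂ : ℝ) : Prop where
  rate_pos : 0 < l
  kinetic₁ : k * a₁ - a₂ = -(l * b₁)
  kinetic₂ : -a₁ + M * a₂ = -(l * b₂)
  potential₁ : S₁₁ * b₁ + S₁₂ * b₂ = l * a₁
  potential₂ : S₁₂ * b₁ + S₂₂ * b₂ = l * a₂
  b₂_pos : 0 < b₂
  pairing_neg : a₁ * b₁ + a₂ * b₂ < 0

theorem exists_isHyperbolicMode {k M S₁₁ S₁₂ S₂₂ : ℝ} (hM : 0 < M) (hkM : 1 < k * M)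
    (h₁₁ : 0 < S₁₁) (hS : S₁₁ * S₂₂ < S₁₂ ^ 2) :
    ∃ l a₁ a₂ b₁ b₂ : ℝ, IsHyperbolicMode k M S₁₁ S₁₂ S₂₂ l a₁ a₂ b₁ b₂ := by
  -- `S b = -L adj(T) b`, that is, `L` is a root of `det (S + L adj(T))`
  obtain ⟨L, hL, hroot⟩ := exists_pos_root_of_neg (a := k * M - 1)
    (b := k * S₁₁ + M * S₂₂ - 2 * S₁₂) (c := S₁₁ * S₂₂ - S₁₂ ^ 2) (by linarith) (by linarith)
  have : 0 < k * M - 1 := by linarith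
  set l := √(L * (k * M - 1))
  have hl : 0 < l := Real.sqrt_pos.2 (by positivity)
  have hl2 : l ^ 2 = L * (k * M - 1) := Real.sq_sqrt (by positivity)
  set b₁ := -(S₁₂ + L) with hb₁
  set b₂ := S₁₁ + L * M with hb₂
  have hSb₁ : S₁₁ * b₁ + S₁₂ * b₂ = -(L * (M * b₁ + b₂)) := by rw [hb₁, hb₂]; ring
  have hSb₂ : S₁₂ * b₁ + S₂₂ * b₂ = -(L * (b₁ + k * b₂)) := by
    rw [hb₁, hb₂]; linear_combination hroot
  have hb₂_pos : 0 < b₂ := by positivity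
  refine ⟨l, -(L * (M * b₁ + b₂)) / l, -(L * (b₁ + k * b₂)) / l, b₁, b₂, hl, ?_, ?_, ?_, ?_,
    hb₂_pos, ?_⟩
  · field_simp
    linear_combination b₁ * hl2
  · field_simp
    linear_combination b₂ * hl2
  · rw [hSb₁]; field_simp
  · rw [hSb₂]; field_simp
  · have hform := binaryForm_pos (β := 1) (γ := k) hM (by linarith) (a := b₁) (Or.inr hb₂_pos.ne')
    have hpairing : -(L * (M * b₁ + b₂)) / l * b₁ + -(L * (b₁ + k * b₂)) / l * b₂ =
        -(L / l * (M * b₁ ^ 2 + 2 * 1 * b₁ * b₂ + k * b₂ ^ 2)) := by ring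
    rw [hpairing]
    exact neg_neg_of_pos (mul_pos (div_pos hL hl) hform)

theorem IsHyperbolicMode.exists_add_sq_pos {k M S₁₁ S₁₂ S₂₂ l a₁ a₂ b₁ b₂ : ℝ}
    (h : IsHyperbolicMode k M S₁₁ S₁₂ S₂₂ l a₁ a₂ b₁ b₂) (h₁₁ : 0 < S₁₁)
    (hS : S₁₁ * S₂₂ < S₁₂ ^ 2) :
    ∃ κ : ℝ, 0 < S₁₁ + 2 * κ * a₁ ^ 2 ∧
      (S₁₂ + 2 * κ * (a₁ * a₂)) ^ 2 < (S₁₁ + 2 * κ * a₁ ^ 2) * (S₂₂ + 2 * κ * a₂ ^ 2) := by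
  set X := S₁₁ * a₂ ^ 2 - 2 * S₁₂ * (a₁ * a₂) + S₂₂ * a₁ ^ 2 with hX
  have hlX : l * X = (S₁₁ * S₂₂ - S₁₂ ^ 2) * (a₁ * b₁ + a₂ * b₂) := by
    rw [hX]
    linear_combination (-(S₂₂ * a₁) + S₁₂ * a₂) * h.potential₁ +
      (S₁₂ * a₁ - S₁₁ * a₂) * h.potential₂
  have hX_pos : 0 < X := by
    refine pos_of_mul_pos_right (hlX ▸ ?_) h.rate_pos.le
    exact mul_pos_of_neg_of_neg (by linarith) h.pairing_neg
  have : 0 < S₁₂ ^ 2 - S₁₁ * S₂₂ := by linarith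
  refine ⟨(S₁₂ ^ 2 - S₁₁ * S₂₂) / X, by positivity, sub_pos.1 ?_⟩
  have hdet (κ : ℝ) : (S₁₁ + 2 * κ * a₁ ^ 2) * (S₂₂ + 2 * κ * a₂ ^ 2) -
      (S₁₂ + 2 * κ * (a₁ * a₂)) ^ 2 = S₁₁ * S₂₂ - S₁₂ ^ 2 + 2 * (κ * X) := by rw [hX]; ring
  rw [hdet, div_mul_cancel₀ _ hX_pos.ne']
  linarith

end QuadraticForms

section Equilibria

/-- The state in which the particles are at distance `q` and the angular momentum in the moving
frame is `(0, r Z, Z)`. -/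
def equilibriumState (r Z q : ℝ) : RedVec := (![0, r * Z, Z], q, 0)

/-- The conditions for `equilibriumState r Z q` to be an equilibrium of the reduced system, with
`c = coth q`, `M = 1 + μ₁ / μ₂` and `g = G μ₁² μ₂`. -/
structure IsEquilibriumData (M g r Z c : ℝ) : Prop where
  one_lt_M : 1 < M
  g_pos : 0 < g
  r_pos : 0 < r
  Z_ne : Z ≠ 0
  one_lt_c : 1 < c
  ratio : c * (r ^ 2 + 1) = (M * (c ^ 2 - 1) + 2) * r
  balance : Z ^ 2 * (M * c - r) = g

namespace IsEquilibriumData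

variable {M g r Z c q : ℝ}

theorem M_pos (h : IsEquilibriumData M g r Z c) : 0 < M := one_pos.trans h.one_lt_M

theorem sq_sub_one_pos (h : IsEquilibriumData M g r Z c) : 0 < c ^ 2 - 1 := by
  nlinarith [h.one_lt_c]

theorem c_div_r_pos (h : IsEquilibriumData M g r Z c) : 0 < c / r :=
  div_pos (one_pos.trans h.one_lt_c) h.r_pos

theorem r_lt_mul (h : IsEquilibriumData M g r Z c) : r < M * c :=
  sub_pos.1 (pos_of_mul_pos_right (h.balance ▸ h.g_pos) (sq_nonneg Z))

theorem one_lt_div_mul (h : IsEquilibriumData M g r Z c) : 1 < c / r * M := by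
  rw [div_mul_eq_mul_div, one_lt_div h.r_pos, mul_comm]
  exact h.r_lt_mul

theorem ratio_eq (h : IsEquilibriumData M g r Z c) :
    M * (c ^ 2 - 1) + 2 = c / r * (r ^ 2 + 1) := by
  rw [div_mul_eq_mul_div, eq_div_iff h.r_pos.ne', ← h.ratio]

theorem scaledField_eq_zero (h : IsEquilibriumData M g r Z (coth q)) :
    scaledField M g (equilibriumState r Z q) = 0 := by
  refine Prod.ext (funext fun i => ?_) (Prod.ext ?_ ?_)
  · fin_cases i
    · simp only [scaledField, equilibriumState, Fin.zero_eta, Matrix.cons_val, Prod.fst_zero,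
        Pi.zero_apply]
      linear_combination -Z ^ 2 * h.ratio
    all_goals simp [scaledField, equilibriumState]
  · simp [scaledField, equilibriumState]
  · simp only [scaledField, equilibriumState, Matrix.cons_val, Prod.snd_zero]
    linear_combination (coth q ^ 2 - 1) * h.balance

end IsEquilibriumData

end Equilibria

section Linearization

/-- The linear coordinate `u` for which `(y, z) = Z u (1, r) + w / (1 - r²) (r, 1)`, where `w` is
`leafCoord r`; it is meaningful for `Z ≠ 0` and `r² ≠ 1`. -/
def evenCoord (r Z : ℝ) : RedVec →L[ℝ] ℝ :=
  (Z * (1 - r ^ 2))⁻¹ • ((ContinuousLinearMap.proj 1 - r • ContinuousLinearMap.proj 2) ∘L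
    ContinuousLinearMap.fst ℝ Vec (ℝ × ℝ))

/-- The linear coordinate `w = z - r y`, which is proportional to the derivative of the Casimir
function at `equilibriumState r Z q` and so vanishes on the tangent space of the symplectic leaf. -/
def leafCoord (r : ℝ) : RedVec →L[ℝ] ℝ :=
  (ContinuousLinearMap.proj 2 - r • ContinuousLinearMap.proj 1) ∘L
    ContinuousLinearMap.fst ℝ Vec (ℝ × ℝ)

theorem evenCoord_apply (r Z : ℝ) (v : RedVec) :
    evenCoord r Z v = (v.1 1 - r * v.1 2) / (Z * (1 - r ^ 2)) := by
  simp [evenCoord, div_eq_inv_mul]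

theorem leafCoord_apply (r : ℝ) (v : RedVec) : leafCoord r v = v.1 2 - r * v.1 1 := by
  simp [leafCoord]

theorem fst_one_eq {r Z : ℝ} (hZ : Z ≠ 0) (hr : r ^ 2 ≠ 1) (v : RedVec) :
    v.1 1 = Z * evenCoord r Z v + r / (1 - r ^ 2) * leafCoord r v := by
  have hN : 1 - r ^ 2 ≠ 0 := sub_ne_zero.2 hr.symm
  rw [evenCoord_apply, leafCoord_apply]
  field_simp
  ring

theorem fst_two_eq {r Z : ℝ} (hZ : Z ≠ 0) (hr : r ^ 2 ≠ 1) (v : RedVec) :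
    v.1 2 = Z * r * evenCoord r Z v + 1 / (1 - r ^ 2) * leafCoord r v := by
  have hN : 1 - r ^ 2 ≠ 0 := sub_ne_zero.2 hr.symm
  rw [evenCoord_apply, leafCoord_apply]
  field_simp
  ring

theorem fderiv_casimir_equilibriumState (r Z q : ℝ) (v : RedVec) :
    fderiv ℝ casimir (equilibriumState r Z q) v = 2 * Z * leafCoord r v := by
  rw [fderiv_casimir, mink_eq, leafCoord_apply]
  simp only [equilibriumState, Matrix.cons_val]
  ring

theorem fderiv_casimir_equilibriumState_eq_zero_iff {r Z q : ℝ} (hZ : Z ≠ 0) {v : RedVec} :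
    fderiv ℝ casimir (equilibriumState r Z q) v = 0 ↔ leafCoord r v = 0 := by
  rw [fderiv_casimir_equilibriumState, mul_eq_zero,
    or_iff_right (mul_ne_zero two_ne_zero hZ)]

/-- The entry `S₁₁` of the second variation of the energy-Casimir function in the coordinates
`(u, e) = (evenCoord r Z, -q)`. -/
def S₁₁ (r Z c : ℝ) : ℝ := c / r * (Z * (1 - r ^ 2)) ^ 2

/-- The entry `S₁₂` of the second variation of the energy-Casimir function in the coordinates
`(u, e) = (evenCoord r Z, -q)`. -/
def S₁₂ (M r Z c : ℝ) : ℝ := Z ^ 2 * (2 * M * c * r - 1 - r ^ 2) * (c ^ 2 - 1)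

/-- The entry `S₂₂` of the second variation of the energy-Casimir function in the coordinates
`(u, e) = (evenCoord r Z, -q)`. -/
def S₂₂ (M Z c : ℝ) : ℝ := M * Z ^ 2 * (c ^ 2 - 1) ^ 2

/-- The coefficient of the term in which the second variation depends on `leafCoord r`. -/
def leafCoupling (M r Z c : ℝ) : ℝ := 2 * Z * (c ^ 2 - 1) * (M * c - r) / (1 - r ^ 2)

theorem IsEquilibriumData.S₁₁_pos {M g r Z c : ℝ} (h : IsEquilibriumData M g r Z c)
    (hr : r ^ 2 ≠ 1) : 0 < S₁₁ r Z c :=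
  mul_pos h.c_div_r_pos (sq_pos_of_ne_zero (mul_ne_zero h.Z_ne (sub_ne_zero.2 hr.symm)))

theorem S₁₁_mul_evenCoord {r Z : ℝ} (hZ : Z ≠ 0) (hr : r ^ 2 ≠ 1) (c : ℝ) (v : RedVec) :
    S₁₁ r Z c * evenCoord r Z v = c / r * (Z * (1 - r ^ 2)) * (v.1 1 - r * v.1 2) := by
  have hN : 1 - r ^ 2 ≠ 0 := sub_ne_zero.2 hr.symm
  rw [evenCoord_apply, S₁₁]
  field_simp

theorem S₁₂_mul_evenCoord_add_leafCoupling_mul {r Z : ℝ} (hZ : Z ≠ 0) (hr : r ^ 2 ≠ 1) (M c : ℝ)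
    (v : RedVec) :
    S₁₂ M r Z c * evenCoord r Z v + leafCoupling M r Z c * leafCoord r v =
      (c ^ 2 - 1) * Z * ((2 * M * c - r) * v.1 2 - v.1 1) := by
  have hN : 1 - r ^ 2 ≠ 0 := sub_ne_zero.2 hr.symm
  rw [evenCoord_apply, leafCoord_apply, S₁₂, leafCoupling]
  field_simp
  ring

theorem hasDerivAt_vec3 {f₀ f₁ f₂ : ℝ → ℝ} {d₀ d₁ d₂ t : ℝ} (h₀ : HasDerivAt f₀ d₀ t)
    (h₁ : HasDerivAt f₁ d₁ t) (h₂ : HasDerivAt f₂ d₂ t) :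
    HasDerivAt (fun s => ![f₀ s, f₁ s, f₂ s]) ![d₀, d₁, d₂] t :=
  hasDerivAt_pi.2 fun i => by fin_cases i <;> assumption

theorem IsEquilibriumData.fderiv_scaledField {M g r Z q : ℝ}
    (h : IsEquilibriumData M g r Z (coth q)) (hq : 0 < q) (hr : r ^ 2 ≠ 1) (v : RedVec) :
    fderiv ℝ (scaledField M g) (equilibriumState r Z q) v =
      (![S₁₁ r Z (coth q) * evenCoord r Z v - S₁₂ M r Z (coth q) * v.2.1,
         Z * (v.2.2 - coth q / r * v.1 0), r * Z * (v.2.2 - coth q / r * v.1 0)],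
       M * v.2.2 - v.1 0,
       S₁₂ M r Z (coth q) * evenCoord r Z v + leafCoupling M r Z (coth q) * leafCoord r v
         - S₂₂ M Z (coth q) * v.2.1) := by
  have hmem : equilibriumState r Z q ∈ redSpace := hq
  rw [← ((contDiffAt_scaledField M g (n := 1) hmem).differentiableAt
    one_ne_zero).lineDeriv_eq_fderiv, S₁₁_mul_evenCoord h.Z_ne hr,
    S₁₂_mul_evenCoord_add_leafCoupling_mul h.Z_ne hr, S₁₂, S₂₂]
  have hc : HasDerivAt (fun t : ℝ => coth (q + t * v.2.1)) (-(coth q ^ 2 - 1) * v.2.1) 0 :=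
    hasDerivAt_coth_line hmem v
  have hx := hasDerivAt_line 0 (v.1 0)
  have hy := hasDerivAt_line (r * Z) (v.1 1)
  have hz := hasDerivAt_line Z (v.1 2)
  have hp := hasDerivAt_line 0 v.2.2
  have hE := (((hc.pow 2).sub_const 1).const_mul M).add_const 2
  have hline : HasLineDerivAt ℝ (scaledField M g) _ (equilibriumState r Z q) v :=
    (hasDerivAt_vec3 ((hc.neg.mul ((hy.pow 2).add (hz.pow 2))).add ((hE.mul hy).mul hz))
      (((hz.mul hp).sub ((hE.mul hx).mul hz)).add ((hc.mul hx).mul hy))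
      ((hy.mul hp).sub ((hc.mul hx).mul hz))).prodMk
      (((hp.const_mul M).sub hx).prodMk (((hc.pow 2).sub_const 1).mul
        ((((hc.const_mul M).mul (hz.pow 2)).sub (hy.mul hz)).sub_const g)))
  have hk : coth q / r * r = coth q := div_mul_cancel₀ _ h.r_pos.ne'
  rw [hline.lineDeriv]
  simp only [zero_mul, mul_zero, add_zero, Pi.pow_apply, Pi.mul_apply, Pi.neg_apply, Pi.add_apply]
  refine Prod.ext (funext fun i => ?_) (Prod.ext rfl ?_)
  · fin_cases i <;> simp only [Fin.mk_one, Fin.zero_eta, Fin.reduceFinMk, Matrix.cons_val]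
    · linear_combination Z * (v.1 1 + r * v.1 2) * h.ratio_eq + 2 * Z * (r * v.1 1 + v.1 2) * hk
    · linear_combination -Z * v.1 0 * h.ratio_eq - Z * r * v.1 0 * hk
    · linear_combination Z * v.1 0 * hk
  · simp only [equilibriumState, zero_smul, Prod.fst_zero, Prod.snd_zero, Pi.zero_apply, add_zero,
      Matrix.cons_val]
    linear_combination -2 * coth q * (coth q ^ 2 - 1) * v.2.1 * h.balance

end Linearization

section SecondVariation

open Asymptotics Filter Topology

/-- The energy-Casimir function, that is, the combination of the Hamiltonian and the Casimir
function that is critical at `equilibriumState r Z q` for `c = coth q`. -/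
def energyCasimir (M g r c : ℝ) (z : RedVec) : ℝ :=
  scaledHamiltonian M g z - 1 / 2 * (c / r - 1) * casimir z

/-- The second variation of the energy-Casimir function at `equilibriumState r Z q`, for
`c = coth q`. -/
def secondVariation (M r Z c : ℝ) (v : RedVec) : ℝ :=
  1 / 2 * (c / r * v.1 0 ^ 2 - 2 * v.1 0 * v.2.2 + M * v.2.2 ^ 2) +
    1 / 2 * (S₁₁ r Z c * evenCoord r Z v ^ 2 - 2 * S₁₂ M r Z c * evenCoord r Z v * v.2.1 +
      S₂₂ M Z c * v.2.1 ^ 2) - leafCoupling M r Z c * leafCoord r v * v.2.1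

theorem secondVariation_smul (M r Z c t : ℝ) (v : RedVec) :
    secondVariation M r Z c (t • v) = t ^ 2 * secondVariation M r Z c v := by
  simp only [secondVariation, map_smul, Prod.smul_fst, Prod.smul_snd, Pi.smul_apply, smul_eq_mul]
  ring

theorem continuous_secondVariation (M r Z c : ℝ) : Continuous (secondVariation M r Z c) := by
  unfold secondVariation
  fun_prop

variable {M g r Z q : ℝ}

theorem secondVariation_eq {r Z : ℝ} (hZ : Z ≠ 0) (hr : r ^ 2 ≠ 1) (M c : ℝ) (v : RedVec) :
    secondVariation M r Z c v =
      1 / 2 * (c / r * v.1 0 ^ 2 - 2 * v.1 0 * v.2.2 + M * v.2.2 ^ 2) +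
        1 / 2 * (c / r) * (v.1 1 - r * v.1 2) ^ 2 -
        (c ^ 2 - 1) * v.2.1 * Z * ((2 * M * c - r) * v.1 2 - v.1 1) +
        1 / 2 * M * Z ^ 2 * (c ^ 2 - 1) ^ 2 * v.2.1 ^ 2 := by
  have hN : 1 - r ^ 2 ≠ 0 := sub_ne_zero.2 hr.symm
  have hu : Z * (1 - r ^ 2) * evenCoord r Z v = v.1 1 - r * v.1 2 := by
    rw [evenCoord_apply, mul_div_cancel₀ _ (mul_ne_zero hZ hN)]
  rw [secondVariation, S₂₂]
  linear_combination 1 / 2 * evenCoord r Z v * S₁₁_mul_evenCoord hZ hr c v +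
    1 / 2 * (c / r) * (v.1 1 - r * v.1 2) * hu -
    v.2.1 * S₁₂_mul_evenCoord_add_leafCoupling_mul hZ hr M c v

theorem IsEquilibriumData.energyCasimir_sub_eq (h : IsEquilibriumData M g r Z (coth q))
    (hr : r ^ 2 ≠ 1) (z : RedVec) :
    energyCasimir M g r (coth q) z - energyCasimir M g r (coth q) (equilibriumState r Z q) -
        secondVariation M r Z (coth q) (z - equilibriumState r Z q) =
      (coth z.2.1 - coth q - (z.2.1 - q) • -(coth q ^ 2 - 1)) *
          (Z * ((2 * M * coth q - r) * (z.1 2 - Z) - (z.1 1 - r * Z)) +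
            1 / 2 * M * Z ^ 2 * (coth z.2.1 - coth q - (coth q ^ 2 - 1) * (z.2.1 - q))) +
        (coth z.2.1 - coth q) * (z.1 2 - Z) *
          (-(z.1 1 - r * Z) + M * coth q * (z.1 2 - Z) + M * Z * (coth z.2.1 - coth q) +
            1 / 2 * M * (coth z.2.1 - coth q) * (z.1 2 - Z)) := by
  have hk : coth q / r * r = coth q := div_mul_cancel₀ _ h.r_pos.ne'
  rw [secondVariation_eq h.Z_ne hr]
  simp only [energyCasimir, scaledHamiltonian, energy, casimir, mink_eq, equilibriumState,
    Prod.fst_sub, Prod.snd_sub, Pi.sub_apply, Matrix.cons_val, sub_zero, smul_eq_mul]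
  linear_combination 1 / 2 * (z.1 2 ^ 2 - Z ^ 2) * h.ratio_eq +
    (coth z.2.1 - coth q) * h.balance + (z.1 1 * z.1 2 - r * Z ^ 2) * hk

theorem IsEquilibriumData.isSecondVariation (h : IsEquilibriumData M g r Z (coth q)) (hq : 0 < q)
    (hr : r ^ 2 ≠ 1) :
    IsSecondVariation (energyCasimir M g r (coth q)) (secondVariation M r Z (coth q))
      (equilibriumState r Z q) where
  continuous := continuous_secondVariation _ _ _ _
  homogeneous := secondVariation_smul _ _ _ _
  isLittleO := by
    have hmem : equilibriumState r Z q ∈ redSpace := hq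
    have hcoth : DifferentiableAt ℝ (fun z : RedVec => coth z.2.1) (equilibriumState r Z q) :=
      (contDiffAt_coth_coordinate (n := 1) hmem).differentiableAt one_ne_zero
    have hO {f : RedVec → ℝ} (hf : DifferentiableAt ℝ f (equilibriumState r Z q))
        (hf₀ : f (equilibriumState r Z q) = 0) :
        f =O[𝓝 (equilibriumState r Z q)] fun z => ‖z - equilibriumState r Z q‖ := by
      simpa only [hf₀, sub_zero] using hf.isBigO_sub.norm_right
    have hq_O := hO (f := fun z => z.2.1 - q) (by fun_prop) (sub_self q)
    have hz_O := hO (f := fun z => z.1 2 - Z) (by fun_prop) (sub_self Z)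
    have hcoth_O := hO (f := fun z => coth z.2.1 - coth q) (by fun_prop) (sub_self _)
    have hcoth_o : (fun z : RedVec => coth z.2.1 - coth q - (z.2.1 - q) • -(coth q ^ 2 - 1))
        =o[𝓝 (equilibriumState r Z q)] fun z => ‖z - equilibriumState r Z q‖ :=
      ((hasDerivAt_coth hq).isLittleO.comp_tendsto (k := fun z : RedVec => z.2.1)
        (by fun_prop : ContinuousAt _ (equilibriumState r Z q))).trans_isBigO hq_O
    have hbracket : Tendsto (fun z : RedVec => -(z.1 1 - r * Z) + M * coth q * (z.1 2 - Z) +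
        M * Z * (coth z.2.1 - coth q) + 1 / 2 * M * (coth z.2.1 - coth q) * (z.1 2 - Z))
        (𝓝 (equilibriumState r Z q)) (𝓝 0) := by
      refine (DifferentiableAt.continuousAt (𝕜 := ℝ) (by fun_prop)).tendsto.trans (le_of_eq ?_)
      simp [equilibriumState]
    have hcubic := (hcoth_O.mul hz_O).mul_isLittleO ((isLittleO_one_iff ℝ).2 hbracket)
    refine ((hcoth_o.mul_isBigO (hO (by fun_prop) ?_)).add (hcubic.congr_right fun z => mul_one _))
      |>.congr (fun z => (h.energyCasimir_sub_eq hr z).symm) fun z => (sq _).symm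
    simp [equilibriumState]

end SecondVariation

section StabilityOfEquilibria

variable {G μ₁ μ₂ M g r Z c q : ℝ}

theorem IsEquilibriumData.secondVariation_add_sq_pos (h : IsEquilibriumData M g r Z c)
    (hr : r ^ 2 ≠ 1) {κ a₁ a₂ : ℝ} (h₁₁ : 0 < S₁₁ r Z c + 2 * κ * a₁ ^ 2)
    (hS : (S₁₂ M r Z c + 2 * κ * (a₁ * a₂)) ^ 2 <
      (S₁₁ r Z c + 2 * κ * a₁ ^ 2) * (S₂₂ M Z c + 2 * κ * a₂ ^ 2))
    {v : RedVec} (hw : leafCoord r v = 0) (hv : v ≠ 0) :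
    0 < secondVariation M r Z c v + κ * (a₁ * evenCoord r Z v - a₂ * v.2.1) ^ 2 := by
  have hodd := binaryForm_pos (β := -1) (γ := M) h.c_div_r_pos (by linarith [h.one_lt_div_mul])
    (a := v.1 0) (b := v.2.2)
  have hodd' := binaryForm_nonneg (β := -1) (γ := M) h.c_div_r_pos (by linarith [h.one_lt_div_mul])
    (v.1 0) v.2.2
  have heven := binaryForm_pos h₁₁ hS (a := evenCoord r Z v) (b := -v.2.1)
  have heven' := binaryForm_nonneg h₁₁ hS (evenCoord r Z v) (-v.2.1)
  rw [secondVariation, hw]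
  by_cases hxp : v.1 0 ≠ 0 ∨ v.2.2 ≠ 0
  · linarith [hodd hxp]
  by_cases hue : evenCoord r Z v ≠ 0 ∨ -v.2.1 ≠ 0
  · linarith [heven hue]
  simp only [ne_eq, not_or, not_not, neg_eq_zero] at hxp hue
  refine absurd (Prod.ext (funext fun i => ?_) (Prod.ext hue.2 hxp.2)) hv
  fin_cases i
  · exact hxp.1
  · simpa [hue.1, hw] using fst_one_eq h.Z_ne hr v
  · simpa [hue.1, hw] using fst_two_eq h.Z_ne hr v

theorem isFirstIntegral_energyCasimir (G : ℝ) (hμ₁ : μ₁ ≠ 0) (r c : ℝ) :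
    IsFirstIntegral (redField μ₁ μ₂ (gravPotential G μ₁ μ₂)) redSpace
      (energyCasimir (1 + μ₁ / μ₂) (G * μ₁ ^ 2 * μ₂) r c) :=
  (isFirstIntegral_scaledHamiltonian G hμ₁).map₂ (isFirstIntegral_casimir μ₁ μ₂ _ _)
    fun H C => H - 1 / 2 * (c / r - 1) * C

theorem continuousOn_energyCasimir (M g r c : ℝ) : ContinuousOn (energyCasimir M g r c) redSpace :=
  .sub (fun _ hz => (contDiffAt_scaledHamiltonian M g (n := 0) hz).continuousAt.continuousWithinAt)
    (continuousOn_const.mul (contDiff_casimir (n := 0)).continuous.continuousOn)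

theorem IsEquilibriumData.redField_eq_zero
    (h : IsEquilibriumData (1 + μ₁ / μ₂) (G * μ₁ ^ 2 * μ₂) r Z (coth q)) (hμ₁ : μ₁ ≠ 0)
    (hq : 0 < q) : redField μ₁ μ₂ (gravPotential G μ₁ μ₂) (equilibriumState r Z q) = 0 := by
  rw [redField_eq_smul G hμ₁ hq, h.scaledField_eq_zero, smul_zero]

theorem hasFDerivAt_redField (G : ℝ) (hμ₁ : μ₁ ≠ 0) {z : RedVec} (hz : z ∈ redSpace) :
    HasFDerivAt (redField μ₁ μ₂ (gravPotential G μ₁ μ₂))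
      ((1 / μ₁) • fderiv ℝ (scaledField (1 + μ₁ / μ₂) (G * μ₁ ^ 2 * μ₂)) z) z := by
  refine (((contDiffAt_scaledField _ _ (n := 1) hz).differentiableAt
    one_ne_zero).hasFDerivAt.const_smul (1 / μ₁)).congr_of_eventuallyEq ?_
  filter_upwards [isOpen_redSpace.mem_nhds hz] with w hw using redField_eq_smul G hμ₁ hw

theorem IsEquilibriumData.isLyapunovStable
    (h : IsEquilibriumData (1 + μ₁ / μ₂) (G * μ₁ ^ 2 * μ₂) r Z (coth q)) (hμ₁ : μ₁ ≠ 0)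
    (hq : 0 < q) (hr : r ^ 2 ≠ 1)
    (hS : S₁₂ (1 + μ₁ / μ₂) r Z (coth q) ^ 2 < S₁₁ r Z (coth q) * S₂₂ (1 + μ₁ / μ₂) Z (coth q)) :
    IsLyapunovStable (redField μ₁ μ₂ (gravPotential G μ₁ μ₂)) redSpace
      (equilibriumState r Z q) := by
  refine isLyapunovStable_of_secondVariation_pos isOpen_redSpace
    (fun z hz => contDiffAt_redField G hμ₁ hz) hq (h.redField_eq_zero hμ₁ hq)
    (continuousOn_energyCasimir _ _ _ _) (isFirstIntegral_energyCasimir G hμ₁ _ _)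
    (contDiff_casimir (n := 0)).continuous.continuousOn (isFirstIntegral_casimir _ _ _ _)
    (h.isSecondVariation hq hr) (contDiff_casimir.differentiable one_ne_zero _).hasFDerivAt
    fun v hCv hv => ?_
  have hpos := h.secondVariation_add_sq_pos hr (κ := 0) (a₁ := 0) (a₂ := 0)
    (by simpa using h.S₁₁_pos hr) (by simpa using hS)
    ((fderiv_casimir_equilibriumState_eq_zero_iff h.Z_ne).1 hCv) hv
  simpa using hpos

theorem isLinearlyUnstable_of_eigenvector {E : Type*} [NormedAddCommGroup E] [NormedSpace ℝ E]
    {X : E → E} {D : Set E} {z₀ v : E} {l : ℝ} (hz₀ : z₀ ∈ D) (hX₀ : X z₀ = 0) (hl : 0 < l)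
    (hv : v ≠ 0) (h : fderiv ℝ X z₀ v = l • v) : IsLinearlyUnstable X D z₀ := by
  refine ⟨hz₀, hX₀, l, by simpa using hl, ?_⟩
  refine Module.End.hasEigenvalue_of_hasEigenvector (x := (1 : ℂ) ⊗ₜ[ℝ] v) ⟨?_, ?_⟩
  · rw [Module.End.mem_eigenspace_iff, LinearMap.baseChange_tmul, ContinuousLinearMap.coe_coe, h,
      TensorProduct.smul_tmul', ← TensorProduct.smul_tmul, ← Complex.coe_smul]
  · exact fun hzero => hv ((Module.FaithfullyFlat.one_tmul_eq_zero_iff ℝ E v (A := ℂ)).1 hzero)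

/-- The tangent vector of the symplectic leaf at `equilibriumState r Z q` with the given
coordinates, where `u` is `evenCoord r Z` and `e = -q`. -/
def leafVector (r Z x u e p : ℝ) : RedVec := (![x, Z * u, r * Z * u], -e, p)

theorem evenCoord_leafVector (hZ : Z ≠ 0) (hr : r ^ 2 ≠ 1) (x u e p : ℝ) :
    evenCoord r Z (leafVector r Z x u e p) = u := by
  have hN : 1 - r ^ 2 ≠ 0 := sub_ne_zero.2 hr.symm
  simp only [evenCoord_apply, leafVector, Matrix.cons_val]
  field_simp

theorem leafCoord_leafVector (r Z x u e p : ℝ) : leafCoord r (leafVector r Z x u e p) = 0 := by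
  simp only [leafCoord_apply, leafVector, Matrix.cons_val]
  ring

theorem IsEquilibriumData.fderiv_scaledField_leafVector (h : IsEquilibriumData M g r Z (coth q))
    (hq : 0 < q) (hr : r ^ 2 ≠ 1) (x u e p : ℝ) :
    fderiv ℝ (scaledField M g) (equilibriumState r Z q) (leafVector r Z x u e p) =
      leafVector r Z (S₁₁ r Z (coth q) * u + S₁₂ M r Z (coth q) * e) (p - coth q / r * x)
        (x - M * p) (S₁₂ M r Z (coth q) * u + S₂₂ M Z (coth q) * e) := by
  rw [h.fderiv_scaledField hq hr, evenCoord_leafVector h.Z_ne hr, leafCoord_leafVector]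
  simp only [leafVector, Matrix.cons_val]
  congr 2 <;> ring_nf

theorem IsEquilibriumData.isLinearlyUnstable
    (h : IsEquilibriumData (1 + μ₁ / μ₂) (G * μ₁ ^ 2 * μ₂) r Z (coth q)) (hμ₁ : 0 < μ₁)
    (hq : 0 < q) (hr : r ^ 2 ≠ 1)
    (hS : S₁₁ r Z (coth q) * S₂₂ (1 + μ₁ / μ₂) Z (coth q) < S₁₂ (1 + μ₁ / μ₂) r Z (coth q) ^ 2) :
    IsLinearlyUnstable (redField μ₁ μ₂ (gravPotential G μ₁ μ₂)) redSpace
      (equilibriumState r Z q) := by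
  obtain ⟨l, a₁, a₂, b₁, b₂, hmode⟩ :=
    exists_isHyperbolicMode h.M_pos h.one_lt_div_mul (h.S₁₁_pos hr) hS
  have heigen : fderiv ℝ (scaledField (1 + μ₁ / μ₂) (G * μ₁ ^ 2 * μ₂)) (equilibriumState r Z q)
      (leafVector r Z a₁ b₁ b₂ a₂) = l • leafVector r Z a₁ b₁ b₂ a₂ := by
    have hu : a₂ - coth q / r * a₁ = l * b₁ := by linarith [hmode.kinetic₁]
    have he : a₁ - (1 + μ₁ / μ₂) * a₂ = l * b₂ := by linarith [hmode.kinetic₂]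
    rw [h.fderiv_scaledField_leafVector hq hr, hmode.potential₁, hmode.potential₂, hu, he]
    simp [leafVector, mul_left_comm]
  refine isLinearlyUnstable_of_eigenvector (v := leafVector r Z a₁ b₁ b₂ a₂) (l := 1 / μ₁ * l) hq
    (h.redField_eq_zero hμ₁.ne' hq) (mul_pos (one_div_pos.2 hμ₁) hmode.rate_pos) (fun hv => ?_) ?_
  · exact hmode.b₂_pos.ne' (neg_eq_zero.1 (congrArg (fun w : RedVec => w.2.1) hv))
  · rw [(hasFDerivAt_redField G hμ₁.ne' hq).fderiv, smul_apply, heigen, smul_smul]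

/-- The linear function `a₁ u + a₂ e` of the coordinates `u = evenCoord r Z` and `e = -q`. -/
def evenForm (r Z a₁ a₂ : ℝ) : RedVec →L[ℝ] ℝ :=
  a₁ • evenCoord r Z - a₂ • (ContinuousLinearMap.fst ℝ ℝ ℝ ∘L ContinuousLinearMap.snd ℝ Vec (ℝ × ℝ))

/-- The linear function `b₁ m₀ + b₂ p`. -/
def oddForm (b₁ b₂ : ℝ) : RedVec →L[ℝ] ℝ :=
  b₁ • (ContinuousLinearMap.proj 0 ∘L ContinuousLinearMap.fst ℝ Vec (ℝ × ℝ)) +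
    b₂ • (ContinuousLinearMap.snd ℝ ℝ ℝ ∘L ContinuousLinearMap.snd ℝ Vec (ℝ × ℝ))

theorem evenForm_apply (r Z a₁ a₂ : ℝ) (v : RedVec) :
    evenForm r Z a₁ a₂ v = a₁ * evenCoord r Z v - a₂ * v.2.1 := by
  simp [evenForm]

theorem oddForm_apply (b₁ b₂ : ℝ) (v : RedVec) : oddForm b₁ b₂ v = b₁ * v.1 0 + b₂ * v.2.2 := by
  simp [oddForm]

theorem IsHyperbolicMode.evenForm_comp_fderiv_scaledField {l a₁ a₂ b₁ b₂ : ℝ}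
    (hmode : IsHyperbolicMode (coth q / r) M (S₁₁ r Z (coth q)) (S₁₂ M r Z (coth q))
      (S₂₂ M Z (coth q)) l a₁ a₂ b₁ b₂) (h : IsEquilibriumData M g r Z (coth q)) (hq : 0 < q)
    (hr : r ^ 2 ≠ 1) :
    evenForm r Z a₁ a₂ ∘L fderiv ℝ (scaledField M g) (equilibriumState r Z q) =
      l • oddForm b₁ b₂ := by
  refine ContinuousLinearMap.ext fun v => ?_
  have hN : 1 - r ^ 2 ≠ 0 := sub_ne_zero.2 hr.symm
  have hZ := h.Z_ne
  have hu : evenCoord r Z (fderiv ℝ (scaledField M g) (equilibriumState r Z q) v) =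
      v.2.2 - coth q / r * v.1 0 := by
    rw [evenCoord_apply, h.fderiv_scaledField hq hr]
    simp only [Matrix.cons_val]
    rw [div_eq_iff (mul_ne_zero hZ hN)]
    ring
  rw [ContinuousLinearMap.comp_apply, evenForm_apply, hu, h.fderiv_scaledField hq hr, smul_apply,
    oddForm_apply, smul_eq_mul]
  linear_combination -v.1 0 * hmode.kinetic₁ - v.2.2 * hmode.kinetic₂

theorem IsHyperbolicMode.oddForm_comp_fderiv_scaledField {l a₁ a₂ b₁ b₂ : ℝ}
    (hmode : IsHyperbolicMode (coth q / r) M (S₁₁ r Z (coth q)) (S₁₂ M r Z (coth q))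
      (S₂₂ M Z (coth q)) l a₁ a₂ b₁ b₂) (h : IsEquilibriumData M g r Z (coth q)) (hq : 0 < q)
    (hr : r ^ 2 ≠ 1) :
    oddForm b₁ b₂ ∘L fderiv ℝ (scaledField M g) (equilibriumState r Z q) =
      l • evenForm r Z a₁ a₂ + (b₂ * leafCoupling M r Z (coth q) / (2 * Z)) •
        fderiv ℝ casimir (equilibriumState r Z q) := by
  refine ContinuousLinearMap.ext fun v => ?_
  have hZ := h.Z_ne
  simp only [ContinuousLinearMap.comp_apply, oddForm_apply, h.fderiv_scaledField hq hr, add_apply,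
    smul_apply, evenForm_apply, fderiv_casimir_equilibriumState, smul_eq_mul, Matrix.cons_val]
  field_simp
  linear_combination evenCoord r Z v * hmode.potential₁ - v.2.1 * hmode.potential₂

theorem IsHyperbolicMode.exists_secondVariation_neg {l a₁ a₂ b₁ b₂ : ℝ}
    (hmode : IsHyperbolicMode (c / r) M (S₁₁ r Z c) (S₁₂ M r Z c) (S₂₂ M Z c) l a₁ a₂ b₁ b₂)
    (hM : 0 < M) (hZ : Z ≠ 0) (hr : r ^ 2 ≠ 1) :
    ∃ v, leafCoord r v = 0 ∧ secondVariation M r Z c v < 0 ∧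
      0 < evenForm r Z a₁ a₂ v * oddForm b₁ b₂ v := by
  have hneg : l * (a₁ * b₁ + a₂ * b₂) < 0 := mul_neg_of_pos_of_neg hmode.rate_pos hmode.pairing_neg
  set p := √(-(l * (a₁ * b₁ + a₂ * b₂)) / (2 * M)) with hp
  have hp_sq : M * p ^ 2 = -(l * (a₁ * b₁ + a₂ * b₂)) / 2 := by
    rw [hp, Real.sq_sqrt (div_nonneg (neg_nonneg.2 hneg.le) (by positivity))]
    field_simp
  have hp_pos : 0 < p := Real.sqrt_pos.2 (div_pos (neg_pos.2 hneg) (by positivity))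
  have hu := evenCoord_leafVector hZ hr 0 b₁ b₂ (-p)
  refine ⟨leafVector r Z 0 b₁ b₂ (-p), leafCoord_leafVector _ _ _ _ _ _, ?_, ?_⟩
  · rw [secondVariation, hu, leafCoord_leafVector]
    simp only [leafVector, Matrix.cons_val]
    linear_combination 1 / 2 * hp_sq + 1 / 2 * b₁ * hmode.potential₁ +
      1 / 2 * b₂ * hmode.potential₂ + 1 / 4 * hneg
  · rw [evenForm_apply, hu, oddForm_apply]
    simp only [leafVector, Matrix.cons_val]
    nlinarith [mul_pos (mul_pos hmode.b₂_pos hp_pos) (neg_pos.2 hmode.pairing_neg)]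

theorem range_fderiv_casimir_equilibriumState (hZ : Z ≠ 0) (hr : r ^ 2 ≠ 1) (q : ℝ) :
    (fderiv ℝ casimir (equilibriumState r Z q)).range = ⊤ := by
  refine LinearMap.range_eq_top.2 (LinearMap.surjective fun h₀ => hr ?_)
  have hvalue := fderiv_casimir_equilibriumState r Z q (![0, r, 1], 0, 0)
  rw [← ContinuousLinearMap.coe_coe, h₀, leafCoord_apply] at hvalue
  have : 1 - r * r = 0 := by simpa [hZ] using hvalue
  linarith

theorem IsEquilibriumData.isLyapunovUnstableWithin
    (h : IsEquilibriumData (1 + μ₁ / μ₂) (G * μ₁ ^ 2 * μ₂) r Z (coth q)) (hμ₁ : 0 < μ₁)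
    (hq : 0 < q) (hr : r ^ 2 ≠ 1)
    (hS : S₁₁ r Z (coth q) * S₂₂ (1 + μ₁ / μ₂) Z (coth q) < S₁₂ (1 + μ₁ / μ₂) r Z (coth q) ^ 2) :
    IsLyapunovUnstableWithin (redField μ₁ μ₂ (gravPotential G μ₁ μ₂)) redSpace
      {w | casimir w = casimir (equilibriumState r Z q)} (equilibriumState r Z q) := by
  obtain ⟨l, a₁, a₂, b₁, b₂, hmode⟩ :=
    exists_isHyperbolicMode h.M_pos h.one_lt_div_mul (h.S₁₁_pos hr) hS
  obtain ⟨κ, hκ₁₁, hκ⟩ := hmode.exists_add_sq_pos (h.S₁₁_pos hr) hS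
  obtain ⟨v, hv, hqv, hφψ⟩ := hmode.exists_secondVariation_neg h.M_pos h.Z_ne hr
  have hφ : evenForm r Z a₁ a₂ ∘L
      ((1 / μ₁) • fderiv ℝ (scaledField (1 + μ₁ / μ₂) (G * μ₁ ^ 2 * μ₂)) (equilibriumState r Z q)) =
      (1 / μ₁ * l) • oddForm b₁ b₂ + (0 : ℝ) • fderiv ℝ casimir (equilibriumState r Z q) := by
    rw [ContinuousLinearMap.comp_smul, hmode.evenForm_comp_fderiv_scaledField h hq hr, smul_smul,
      zero_smul, add_zero]
  have hψ := congrArg ((1 / μ₁) • ·) (hmode.oddForm_comp_fderiv_scaledField h hq hr)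
  rw [← ContinuousLinearMap.comp_smul, smul_add, smul_smul, smul_smul] at hψ
  refine isLyapunovUnstableWithin_of_hyperbolic_pair isOpen_redSpace
    (fun z hz => contDiffAt_redField G hμ₁.ne' hz) hq (h.redField_eq_zero hμ₁.ne' hq)
    (isFirstIntegral_energyCasimir G hμ₁.ne' _ _) (isFirstIntegral_casimir _ _ _ _)
    (h.isSecondVariation hq hr) (contDiff_casimir.contDiffAt.hasStrictFDerivAt one_ne_zero)
    (range_fderiv_casimir_equilibriumState h.Z_ne hr q) (hasFDerivAt_redField G hμ₁.ne' hq)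
    (mul_pos (one_div_pos.2 hμ₁) hmode.rate_pos) hφ hψ (k := κ) (fun w hw hw₀ => ?_)
    ((fderiv_casimir_equilibriumState_eq_zero_iff h.Z_ne).2 hv) hqv hφψ
  rw [evenForm_apply]
  exact h.secondVariation_add_sq_pos hr hκ₁₁ hκ
    ((fderiv_casimir_equilibriumState_eq_zero_iff h.Z_ne).1 hw) hw₀

end StabilityOfEquilibria

section LorentzGroup

theorem mink_comm (x y : Vec) : mink x y = mink y x := by
  rw [mink_eq, mink_eq]; ring

theorem K_mul_K : K * K = 1 := by
  rw [K, Matrix.diagonal_mul_diagonal, ← Matrix.diagonal_one]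
  congr 1
  ext i
  fin_cases i <;> simp

variable {g ξ : Matrix (Fin 3) (Fin 3) ℝ}

theorem mink_mulVec (hg : gᵀ * K * g = K) (x y : Vec) :
    mink (g *ᵥ x) (g *ᵥ y) = mink x y := by
  rw [mink, mink, ← Matrix.vecMul_transpose, ← Matrix.dotProduct_mulVec, Matrix.mulVec_mulVec,
    Matrix.mulVec_mulVec, hg]

theorem isUnit_of_transpose_mul_K_mul (hg : gᵀ * K * g = K) : IsUnit g := by
  refine .of_mul_eq_one_right (K * gᵀ * K) ?_
  rw [Matrix.mul_assoc K, Matrix.mul_assoc K, hg, K_mul_K]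

theorem eq_of_mulVec_eq_mulVec (hg : gᵀ * K * g = K) {x y : Vec} (h : g *ᵥ x = g *ᵥ y) : x = y :=
  Matrix.mulVec_injective_iff_isUnit.2 (isUnit_of_transpose_mul_K_mul hg) h

theorem transpose_mulVec_cross {R : Type*} [CommRing R] (N : Matrix (Fin 3) (Fin 3) R)
    (u v : Fin 3 → R) : Nᵀ *ᵥ ((N *ᵥ u) ⨯₃ (N *ᵥ v)) = N.det • (u ⨯₃ v) := by
  rw [Matrix.det_fin_three]
  ext i
  fin_cases i <;>
  · simp [cross_apply, Matrix.mulVec, dotProduct, Fin.sum_univ_three]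
    ring

theorem K_mulVec_cross_mulVec (hg : gᵀ * K * g = K) (hdet : g.det = 1) (x y : Vec) :
    (K *ᵥ (g *ᵥ x)) ⨯₃ (K *ᵥ (g *ᵥ y)) = g *ᵥ ((K *ᵥ x) ⨯₃ (K *ᵥ y)) := by
  have hdetK : K.det * K.det = 1 := by rw [← Matrix.det_mul, K_mul_K, Matrix.det_one]
  have hdetN : (K * g * K).det = 1 := by
    rw [Matrix.det_mul, Matrix.det_mul, hdet, mul_one, hdetK]
  have hN (u : Vec) : K *ᵥ (g *ᵥ u) = (K * g * K) *ᵥ (K *ᵥ u) := by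
    rw [Matrix.mulVec_mulVec, Matrix.mulVec_mulVec, Matrix.mul_assoc (K * g), K_mul_K,
      Matrix.mul_one]
  have hinv : g * (K * g * K)ᵀ = 1 := by
    have hNT : (K * g * K)ᵀ = K * gᵀ * K := by
      rw [Matrix.transpose_mul, Matrix.transpose_mul, K, Matrix.diagonal_transpose,
        Matrix.mul_assoc]
    refine mul_eq_one_comm.1 ?_
    rw [hNT, Matrix.mul_assoc K, Matrix.mul_assoc K, hg, K_mul_K]
  have hcross := transpose_mulVec_cross (K * g * K) (K *ᵥ x) (K *ᵥ y)
  rw [hdetN, one_smul, ← hN, ← hN] at hcross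
  rw [← hcross, Matrix.mulVec_mulVec _ g, hinv, Matrix.one_mulVec]

/-- The elements of the Lie algebra `so(2,1)`, in coordinates: the infinitesimal translations along
the two axes through `(0, 0, 1)`, and the infinitesimal rotation about this point. -/
def generator (u v w : ℝ) : Matrix (Fin 3) (Fin 3) ℝ := !![0, -w, v; w, 0, -u; v, -u, 0]

theorem generator_mulVec (u v w : ℝ) (x : Vec) :
    generator u v w *ᵥ x = ![-(w * x 1) + v * x 2, w * x 0 - u * x 2, v * x 0 - u * x 1] := by
  ext i
  fin_cases i <;>
    simp only [generator, Matrix.mulVec, dotProduct, Fin.sum_univ_three, Matrix.of_apply,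
      Matrix.cons_val, Fin.mk_one, Fin.zero_eta, Fin.reduceFinMk] <;> ring

theorem IsGenerator.exists_eq_generator (hξ : IsGenerator ξ) : ∃ u v w, ξ = generator u v w := by
  have entry (i j) : (ξᵀ * K + K * ξ) i j = 0 := by rw [hξ]; rfl
  simp only [K, Matrix.add_apply, Matrix.mul_diagonal, Matrix.diagonal_mul,
    Matrix.transpose_apply, Fin.forall_fin_succ, Fin.succ_zero_eq_one, Fin.succ_one_eq_two,
    IsEmpty.forall_iff, Matrix.cons_val, and_true] at entry
  obtain ⟨⟨h₀₀, h₀₁, h₀₂⟩, ⟨-, h₁₁, h₁₂⟩, -, -, h₂₂⟩ := entry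
  refine ⟨-ξ 2 1, ξ 0 2, ξ 1 0, ?_⟩
  ext i j
  fin_cases i <;> fin_cases j <;>
    simp only [generator, Matrix.of_apply, Matrix.cons_val, Fin.mk_one, Fin.zero_eta,
      Fin.reduceFinMk] <;> linarith

theorem IsGenerator.of_mul_eq_mul {η : Matrix (Fin 3) (Fin 3) ℝ} (hξ : IsGenerator ξ)
    (hg : gᵀ * K * g = K) (hη : ξ * g = g * η) : IsGenerator η := by
  calc ηᵀ * K + K * η = (g * η)ᵀ * K * g + gᵀ * K * (g * η) := by
        rw [Matrix.transpose_mul, Matrix.mul_assoc ηᵀ, Matrix.mul_assoc ηᵀ, hg,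
          ← Matrix.mul_assoc (gᵀ * K), hg]
    _ = gᵀ * (ξᵀ * K + K * ξ) * g := by
        rw [← hη, Matrix.transpose_mul]
        simp only [Matrix.mul_assoc, Matrix.mul_add, Matrix.add_mul]
    _ = 0 := by rw [hξ, Matrix.mul_zero, Matrix.zero_mul]

theorem IsGenerator.exists_mul_eq_mul_generator (hξ : IsGenerator ξ) (hg : gᵀ * K * g = K)
    : ∃ u v w, ξ * g = g * generator u v w := by
  have hη : ξ * g = g * (g⁻¹ * (ξ * g)) := by
    rw [← Matrix.mul_assoc g, Matrix.mul_nonsing_inv _ ((Matrix.isUnit_iff_isUnit_det g).1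
      (isUnit_of_transpose_mul_K_mul hg)), Matrix.one_mul]
  obtain ⟨u, v, w, h⟩ := (hξ.of_mul_eq_mul hg hη).exists_eq_generator
  exact ⟨u, v, w, h ▸ hη⟩

theorem exists_mink_self_eq_of_generator_mulVec_eq_zero {v w : ℝ} (hw : w ≠ 0) {n : Vec}
    (hn : generator 0 v w *ᵥ n = 0) : ∃ k : ℝ, mink n n = k ^ 2 * (v ^ 2 - w ^ 2) := by
  rw [generator_mulVec] at hn
  have h₀ : -(w * n 1) + v * n 2 = 0 := congrFun hn 0
  have h₁ : w * n 0 - 0 * n 2 = 0 := congrFun hn 1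
  have hn₀ : n 0 = 0 := by simpa [hw] using h₁
  have hn₁ : n 1 = v * n 2 / w := by
    rw [eq_div_iff hw]
    linear_combination -h₀
  refine ⟨n 2 / w, ?_⟩
  rw [mink_eq, hn₀, hn₁]
  field_simp
  ring

theorem exists_mink_self_eq_of_mulVec_eq_zero {v w : ℝ} (hw : w ≠ 0) (hg : gᵀ * K * g = K)
    (hη : ξ * g = g * generator 0 v w) {n : Vec} (hn : ξ *ᵥ n = 0) :
    ∃ k : ℝ, mink n n = k ^ 2 * (v ^ 2 - w ^ 2) := by
  obtain ⟨x, rfl⟩ :=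
    Matrix.mulVec_surjective_iff_isUnit.2 (isUnit_of_transpose_mul_K_mul hg) n
  rw [mink_mulVec hg]
  refine exists_mink_self_eq_of_generator_mulVec_eq_zero hw ?_
  refine eq_of_mulVec_eq_mulVec hg ?_
  rw [Matrix.mulVec_mulVec, ← hη, ← Matrix.mulVec_mulVec, hn, Matrix.mulVec_zero]

theorem IsElliptic.sq_lt_sq {v w : ℝ} (hξ : IsElliptic ξ) (hw : w ≠ 0) (hg : gᵀ * K * g = K)
    (hη : ξ * g = g * generator 0 v w) : v ^ 2 < w ^ 2 := by
  obtain ⟨-, -, n, hn, hξn⟩ := hξ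
  obtain ⟨k, hk⟩ := exists_mink_self_eq_of_mulVec_eq_zero hw hg hη hξn
  exact sub_neg.1 (neg_of_mul_neg_right (hk ▸ hn) (sq_nonneg k))

theorem IsHyperbolic.sq_lt_sq {v w : ℝ} (hξ : IsHyperbolic ξ) (hw : w ≠ 0) (hg : gᵀ * K * g = K)
    (hη : ξ * g = g * generator 0 v w) : w ^ 2 < v ^ 2 := by
  obtain ⟨-, -, n, hn, hξn⟩ := hξ
  obtain ⟨k, hk⟩ := exists_mink_self_eq_of_mulVec_eq_zero hw hg hη hξn
  exact sub_pos.1 (pos_of_mul_pos_right (hk ▸ hn) (sq_nonneg k))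

end LorentzGroup

section Orbits

variable {n : Type*} [Fintype n] [DecidableEq n] (ξ : Matrix n n ℝ)

theorem hasDerivAt_exp_smul_mulVec (x : n → ℝ) (t : ℝ) :
    HasDerivAt (fun t : ℝ => NormedSpace.exp (t • ξ) *ᵥ x)
      (ξ *ᵥ (NormedSpace.exp (t • ξ) *ᵥ x)) t := by
  let : NormedRing (Matrix n n ℝ) := Matrix.linftyOpNormedRing
  let : NormedAlgebra ℝ (Matrix n n ℝ) := Matrix.linftyOpNormedAlgebra
  have hexp := hasDerivAt_exp_smul_const' (𝕂 := ℝ) ξ t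
  rw [Matrix.mulVec_mulVec]
  exact ((Matrix.mulVecBilin ℝ ℝ).flip x).toContinuousLinearMap.hasFDerivAt.comp_hasDerivAt t hexp

variable {ξ} {R : ℝ → n → ℝ}

theorem hasDerivAt_of_orbit (hR : ∀ t, R t = NormedSpace.exp (t • ξ) *ᵥ R 0) (t : ℝ) :
    HasDerivAt R (ξ *ᵥ R t) t := by
  have h := hasDerivAt_exp_smul_mulVec ξ (R 0) t
  rw [← hR t] at h
  exact h.congr_of_eventuallyEq (.of_forall hR)

theorem deriv_deriv_of_orbit (hR : ∀ t, R t = NormedSpace.exp (t • ξ) *ᵥ R 0) (t : ℝ) :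
    deriv (deriv R) t = ξ *ᵥ (ξ *ᵥ R t) := by
  rw [funext fun t => (hasDerivAt_of_orbit hR t).deriv]
  exact (ξ.mulVecLin.toContinuousLinearMap.hasFDerivAt.comp_hasDerivAt t
    (hasDerivAt_of_orbit hR t)).deriv

end Orbits

section NewtonEquations

theorem hdist_comm (x y : Vec) : hdist x y = hdist y x := by
  rw [hdist, mink_comm, hdist]

theorem hdist_eq_of_mink_eq {x y : Vec} {q : ℝ} (hq : 0 ≤ q) (h : mink x y = -Real.cosh q) :
    hdist x y = q := by
  rw [hdist, h, neg_neg, Real.arcosh_cosh hq]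

theorem hasDerivAt_arcosh_cosh {q : ℝ} (hq : 0 < q) :
    HasDerivAt Real.arcosh (Real.sinh q)⁻¹ (Real.cosh q) := by
  have h := Real.hasDerivAt_arcosh (Real.one_lt_cosh.2 hq.ne')
  rwa [Real.cosh_sq, add_sub_cancel_right, Real.sqrt_sq (Real.sinh_pos_iff.2 hq).le] at h

theorem fderiv_comp_hdist {U : ℝ → ℝ} {U' q : ℝ} (hU : HasDerivAt U U' q) (hq : 0 < q)
    {x y : Vec} (h : mink x y = -Real.cosh q) (w : Vec) :
    fderiv ℝ (fun x => U (hdist x y)) x w = -(U' / Real.sinh q) * mink w y := by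
  have hmink : HasFDerivAt (fun x => -mink x y)
      (-((dotProductBilin ℝ ℝ).flip (K *ᵥ y)).toContinuousLinearMap) x :=
    ((dotProductBilin ℝ ℝ).flip (K *ᵥ y)).toContinuousLinearMap.hasFDerivAt.fun_neg
  have hcomp : HasDerivAt (U ∘ Real.arcosh) (U' * (Real.sinh q)⁻¹) (-mink x y) := by
    refine HasDerivAt.comp _ ?_ ?_
    · rwa [h, neg_neg, Real.arcosh_cosh hq.le]
    · rw [h, neg_neg]
      exact hasDerivAt_arcosh_cosh hq
  have hderiv : HasFDerivAt (fun x => U (hdist x y)) ((U' * (Real.sinh q)⁻¹) •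
      -((dotProductBilin ℝ ℝ).flip (K *ᵥ y)).toContinuousLinearMap) x :=
    HasDerivAt.comp_hasFDerivAt (f := fun x => -mink x y) x hcomp hmink
  rw [hderiv.fderiv, div_eq_mul_inv, neg_mul, ← mul_neg]
  rfl

theorem hasDerivAt_gravPotential (G μ₁ μ₂ : ℝ) {q : ℝ} (hq : 0 < q) :
    HasDerivAt (gravPotential G μ₁ μ₂) (G * μ₁ * μ₂ / Real.sinh q ^ 2) q := by
  rw [funext (gravPotential_eq G μ₁ μ₂)]
  refine ((hasDerivAt_coth hq).const_mul _).congr_deriv ?_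
  rw [coth_sq_sub_one hq.ne', neg_mul_neg, div_eq_mul_inv]

variable {μ₁ μ₂ : ℝ} {U : ℝ → ℝ} {R₁ R₂ : ℝ → Vec} {t U' q : ℝ}

theorem IsMotion.newton₁_eq (h : IsMotion μ₁ μ₂ U R₁ R₂) (hU : HasDerivAt U U' q) (hq : 0 < q)
    (hd : mink (R₁ t) (R₂ t) = -Real.cosh q) {w : Vec} (hw : mink (R₁ t) w = 0) :
    μ₁ * mink (deriv (deriv R₁) t) w = U' / Real.sinh q * mink w (R₂ t) := by
  rw [h.newton₁ t w hw, fderiv_comp_hdist hU hq hd, neg_mul, neg_neg]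

theorem IsMotion.newton₂_eq (h : IsMotion μ₁ μ₂ U R₁ R₂) (hU : HasDerivAt U U' q) (hq : 0 < q)
    (hd : mink (R₁ t) (R₂ t) = -Real.cosh q) {w : Vec} (hw : mink (R₂ t) w = 0) :
    μ₂ * mink (deriv (deriv R₂) t) w = U' / Real.sinh q * mink w (R₁ t) := by
  rw [h.newton₂ t w hw]
  simp only [hdist_comm (R₁ t)]
  rw [fderiv_comp_hdist hU hq ((mink_comm _ _).trans hd), neg_mul, neg_neg]

end NewtonEquations

section RelativeEquilibria

/-- The particles of masses `μ₁`, `μ₂` at distance `q`, whose velocities are given in the moving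
frame by `generator 0 v w`, satisfy Newton's equations when the derivative of the potential at `q`
is `F`. -/
structure IsSteadyVelocity (μ₁ μ₂ F q v w : ℝ) : Prop where
  newton₁ : μ₁ * (w * v) = F
  newton₂ : μ₂ * ((v * Real.cosh q - w * Real.sinh q) * (w * Real.cosh q - v * Real.sinh q)) = -F

variable {G μ₁ μ₂ : ℝ} {U : ℝ → ℝ} {ξ g : Matrix (Fin 3) (Fin 3) ℝ} {R₁ R₂ : ℝ → Vec}
  {t F q u v w : ℝ} {z : RedVec}

theorem mink_first_second (hg : gᵀ * K * g = K) (q : ℝ) :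
    mink (g *ᵥ ![0, 0, 1]) (g *ᵥ ![0, Real.sinh q, Real.cosh q]) = -Real.cosh q := by
  rw [mink_mulVec hg, mink_eq]
  simp only [Matrix.cons_val]
  ring

theorem mulVec_mulVec_of_mul_eq_mul {η : Matrix (Fin 3) (Fin 3) ℝ} (hη : ξ * g = g * η) (x : Vec) :
    ξ *ᵥ (g *ᵥ x) = g *ᵥ (η *ᵥ x) := by
  rw [Matrix.mulVec_mulVec, hη, Matrix.mulVec_mulVec]

theorem IsRelativeEquilibrium.isSteadyVelocity (h : IsRelativeEquilibrium μ₁ μ₂ U ξ R₁ R₂)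
    (hU : HasDerivAt U F q) (hq : 0 < q) (hg : gᵀ * K * g = K) (hx₁ : R₁ t = g *ᵥ ![0, 0, 1])
    (hx₂ : R₂ t = g *ᵥ ![0, Real.sinh q, Real.cosh q]) (hη : ξ * g = g * generator u v w) :
    μ₁ * (u * w) = 0 ∧ IsSteadyVelocity μ₁ μ₂ F q v w := by
  obtain ⟨hmotion, -, horbit⟩ := h
  have hs : Real.sinh q ≠ 0 := (Real.sinh_pos_iff.2 hq).ne'
  have hd : mink (R₁ t) (R₂ t) = -Real.cosh q := by rw [hx₁, hx₂, mink_first_second hg]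
  have hN₁ (e : Vec) (he : mink ![0, 0, 1] e = 0) := hmotion.newton₁_eq hU hq hd
    (w := g *ᵥ e) (by rw [hx₁, mink_mulVec hg, he])
  have hN₂ (e : Vec) (he : mink ![0, Real.sinh q, Real.cosh q] e = 0) := hmotion.newton₂_eq hU hq hd
    (w := g *ᵥ e) (by rw [hx₂, mink_mulVec hg, he])
  simp only [deriv_deriv_of_orbit fun t => (horbit t).1, deriv_deriv_of_orbit fun t => (horbit t).2,
    hx₁, hx₂, mulVec_mulVec_of_mul_eq_mul hη, mink_mulVec hg, generator_mulVec, mink_eq,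
    Matrix.cons_val] at hN₁ hN₂
  have h₁ := hN₁ ![1, 0, 0] (by simp)
  have h₂ := hN₁ ![0, 1, 0] (by simp)
  have h₃ := hN₂ ![0, Real.cosh q, Real.sinh q] (by simp; ring)
  simp only [Matrix.cons_val] at h₁ h₂ h₃
  have hF : F / Real.sinh q * Real.sinh q = F := div_mul_cancel₀ F hs
  exact ⟨by linear_combination h₁, by linear_combination h₂ + hF, by linear_combination h₃ - hF⟩

theorem mink_velocity_radial_eq_zero (hg : gᵀ * K * g = K)
    (hη : ξ * g = g * generator 0 v w) (q : ℝ) :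
    mink (ξ *ᵥ (g *ᵥ ![0, Real.sinh q, Real.cosh q]))
      (g *ᵥ ![0, Real.cosh q, Real.sinh q]) = 0 := by
  rw [mulVec_mulVec_of_mul_eq_mul hη, mink_mulVec hg, generator_mulVec, mink_eq]
  simp only [Matrix.cons_val]
  ring

theorem angularMomentum_of_mul_eq_mul_generator (hg : gᵀ * K * g = K) (hdet : g.det = 1)
    (hη : ξ * g = g * generator 0 v w) (μ₁ μ₂ q : ℝ) :
    angularMomentum μ₁ μ₂ (g *ᵥ ![0, 0, 1]) (g *ᵥ ![0, Real.sinh q, Real.cosh q])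
        (ξ *ᵥ (g *ᵥ ![0, 0, 1])) (ξ *ᵥ (g *ᵥ ![0, Real.sinh q, Real.cosh q])) =
      g *ᵥ ![0, -(μ₁ * v) - μ₂ * Real.cosh q * (v * Real.cosh q - w * Real.sinh q),
        -(μ₂ * Real.sinh q * (v * Real.cosh q - w * Real.sinh q))] := by
  rw [angularMomentum, mulVec_mulVec_of_mul_eq_mul hη, mulVec_mulVec_of_mul_eq_mul hη,
    K_mulVec_cross_mulVec hg hdet, K_mulVec_cross_mulVec hg hdet, ← Matrix.mulVec_smul,
    ← Matrix.mulVec_smul, ← Matrix.mulVec_add, generator_mulVec, generator_mulVec, K]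
  congr 1
  ext i
  fin_cases i <;> simp [Matrix.mulVec_diagonal, cross_apply] <;> ring

namespace IsSteadyVelocity

theorem mul_pos (h : IsSteadyVelocity μ₁ μ₂ F q v w) (hμ₁ : 0 < μ₁) (hF : 0 < F) : 0 < w * v :=
  pos_of_mul_pos_right (h.newton₁ ▸ hF) hμ₁.le

theorem force_balance (h : IsSteadyVelocity μ₁ μ₂ F q v w) :
    μ₂ * ((v * Real.cosh q - w * Real.sinh q) * (w * Real.cosh q - v * Real.sinh q)) =
      -(μ₁ * (w * v)) := by
  rw [h.newton₂, h.newton₁]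

theorem momentum_eq (h : IsSteadyVelocity μ₁ μ₂ F q v w) (hw : w ≠ 0) :
    -(μ₁ * v) - μ₂ * Real.cosh q * (v * Real.cosh q - w * Real.sinh q) =
      v / w * -(μ₂ * Real.sinh q * (v * Real.cosh q - w * Real.sinh q)) := by
  field_simp
  linear_combination -h.force_balance

theorem ratio (h : IsSteadyVelocity μ₁ μ₂ F q v w) (hμ₂ : μ₂ ≠ 0) (hq : 0 < q) (hw : w ≠ 0) :
    coth q * ((v / w) ^ 2 + 1) = ((1 + μ₁ / μ₂) * (coth q ^ 2 - 1) + 2) * (v / w) := by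
  have hs : Real.sinh q ≠ 0 := (Real.sinh_pos_iff.2 hq).ne'
  rw [coth_sq_sub_one hq.ne', coth]
  field_simp
  linear_combination (-1) * h.force_balance + μ₂ * v * w * Real.cosh_sq q

theorem balance (h : IsSteadyVelocity μ₁ μ₂ F q v w) (hμ₂ : μ₂ ≠ 0) (hq : 0 < q) (hw : w ≠ 0) :
    (-(μ₂ * Real.sinh q * (v * Real.cosh q - w * Real.sinh q))) ^ 2 *
      ((1 + μ₁ / μ₂) * coth q - v / w) = μ₁ * Real.sinh q ^ 2 * F := by
  have hs : Real.sinh q ≠ 0 := (Real.sinh_pos_iff.2 hq).ne'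
  rw [coth, ← h.newton₁]
  field_simp
  linear_combination (μ₂ * (v * Real.cosh q - w * Real.sinh q) - μ₁ * w * Real.sinh q) *
      h.force_balance +
    μ₁ * μ₂ * w * (v * Real.cosh q - w * Real.sinh q) * v * Real.cosh_sq q

theorem isEquilibriumData (hG : 0 < G) (hμ₁ : 0 < μ₁) (hμ₂ : 0 < μ₂) (hq : 0 < q)
    (h : IsSteadyVelocity μ₁ μ₂ (G * μ₁ * μ₂ / Real.sinh q ^ 2) q v w) :
    IsEquilibriumData (1 + μ₁ / μ₂) (G * μ₁ ^ 2 * μ₂) (v / w)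
      (-(μ₂ * Real.sinh q * (v * Real.cosh q - w * Real.sinh q))) (coth q) := by
  have : 0 < Real.sinh q := Real.sinh_pos_iff.2 hq
  have hwv : 0 < w * v := h.mul_pos hμ₁ (by positivity)
  have hw : w ≠ 0 := left_ne_zero_of_mul hwv.ne'
  have hf : v * Real.cosh q - w * Real.sinh q ≠ 0 := fun hf => by
    have hbalance := h.force_balance
    rw [hf, zero_mul, mul_zero, zero_eq_neg] at hbalance
    exact (_root_.mul_pos hμ₁ hwv).ne' hbalance
  refine ⟨lt_add_of_pos_right 1 (by positivity), by positivity, ?_, ?_, one_lt_coth hq,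
    h.ratio hμ₂.ne' hq hw, ?_⟩
  · rw [← mul_div_mul_left v w hw]
    exact div_pos hwv (mul_self_pos.2 hw)
  · exact neg_ne_zero.2 (mul_ne_zero (by positivity) hf)
  · rw [h.balance hμ₂.ne' hq hw]
    field_simp

end IsSteadyVelocity

theorem IsRelativeEquilibrium.exists_isSteadyVelocity
    (h : IsRelativeEquilibrium μ₁ μ₂ U ξ R₁ R₂)
    (hz : IsReducedState μ₁ μ₂ (R₁ t) (R₂ t) (deriv R₁ t) (deriv R₂ t) z)
    (hU : HasDerivAt U F z.2.1) (hμ₁ : μ₁ ≠ 0) (hF : F ≠ 0) :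
    hdist (R₁ t) (R₂ t) = z.2.1 ∧ ∃ v w : ℝ, IsSteadyVelocity μ₁ μ₂ F z.2.1 v w ∧
      z = (![0, -(μ₁ * v) - μ₂ * Real.cosh z.2.1 * (v * Real.cosh z.2.1 - w * Real.sinh z.2.1),
        -(μ₂ * Real.sinh z.2.1 * (v * Real.cosh z.2.1 - w * Real.sinh z.2.1))], z.2.1, 0) ∧
      (IsElliptic ξ → v ^ 2 < w ^ 2) ∧ (IsHyperbolic ξ → w ^ 2 < v ^ 2) := by
  obtain ⟨m, q, p⟩ := z
  obtain ⟨hq, g, hg, hdet, hx₁, hx₂, hm, hp⟩ := hz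
  dsimp only at hU hx₂ hm hp ⊢
  replace hq : 0 < q := hq
  obtain ⟨u, v, w, hη⟩ := h.2.1.exists_mul_eq_mul_generator hg
  obtain ⟨huw, hvw⟩ := h.isSteadyVelocity hU hq hg hx₁ hx₂ hη
  have hw : w ≠ 0 := by
    rintro rfl
    exact hF (by rw [← hvw.newton₁, zero_mul, mul_zero])
  obtain rfl : u = 0 := by simpa [hμ₁, hw] using huw
  rw [(hasDerivAt_of_orbit (fun t => (h.2.2 t).1) t).deriv,
    (hasDerivAt_of_orbit (fun t => (h.2.2 t).2) t).deriv, hx₁, hx₂,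
    angularMomentum_of_mul_eq_mul_generator hg hdet hη] at hm
  rw [(hasDerivAt_of_orbit (fun t => (h.2.2 t).2) t).deriv, hx₂,
    mink_velocity_radial_eq_zero hg hη, mul_zero] at hp
  refine ⟨?_, v, w, hvw, by rw [hp, ← eq_of_mulVec_eq_mulVec hg hm],
    fun he => he.sq_lt_sq hw hg hη, fun hh => hh.sq_lt_sq hw hg hη⟩
  rw [hx₁, hx₂, hdist_eq_of_mink_eq hq.le (mink_first_second hg q)]

theorem IsRelativeEquilibrium.exists_isEquilibriumData (hG : 0 < G) (hμ₁ : 0 < μ₁) (hμ₂ : 0 < μ₂)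
    (h : IsRelativeEquilibrium μ₁ μ₂ (gravPotential G μ₁ μ₂) ξ R₁ R₂)
    (hz : IsReducedState μ₁ μ₂ (R₁ t) (R₂ t) (deriv R₁ t) (deriv R₂ t) z) :
    ∃ r Z q : ℝ, z = equilibriumState r Z q ∧ hdist (R₁ t) (R₂ t) = q ∧ 0 < q ∧
      IsEquilibriumData (1 + μ₁ / μ₂) (G * μ₁ ^ 2 * μ₂) r Z (coth q) ∧
      (IsElliptic ξ → r ^ 2 < 1) ∧ (IsHyperbolic ξ → 1 < r ^ 2) := by
  have hq : 0 < z.2.1 := hz.1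
  have hF : 0 < G * μ₁ * μ₂ / Real.sinh z.2.1 ^ 2 := by
    have := Real.sinh_pos_iff.2 hq
    positivity
  obtain ⟨hd, v, w, hvw, hz_eq, hell, hhyp⟩ :=
    h.exists_isSteadyVelocity hz (hasDerivAt_gravPotential G μ₁ μ₂ hq) hμ₁.ne' hF.ne'
  have hw : w ≠ 0 := left_ne_zero_of_mul (hvw.mul_pos hμ₁ hF).ne'
  rw [hvw.momentum_eq hw] at hz_eq
  refine ⟨_, _, _, hz_eq, hd, hq, hvw.isEquilibriumData hG hμ₁ hμ₂ hq, fun he => ?_, fun hh => ?_⟩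
  · rw [div_pow, div_lt_one (by positivity)]
    exact hell he
  · rw [div_pow, one_lt_div (by positivity)]
    exact hhyp hh

end RelativeEquilibria

section Threshold

/-- The function of `α` whose value `1` determines the stability threshold `α*`. -/
def threshold (μ α : ℝ) : ℝ := 2 * Real.sinh α ^ 2 * (√(1 + μ ^ 2 * Real.sinh (2 * α) ^ 2) - 1)

/-- The distance of the particles in the elliptic relative equilibria with `r = tanh α`. -/
def distanceOf (μ α : ℝ) : ℝ := α + 1 / 2 * Real.arsinh (μ * Real.sinh (2 * α))

theorem threshold_eq_one_iff (μ α : ℝ) : threshold μ α = 1 ↔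
    2 * Real.sinh α ^ 2 + 1 = 2 * Real.sinh α ^ 2 * √(1 + μ ^ 2 * Real.sinh (2 * α) ^ 2) := by
  rw [threshold]
  constructor <;> intro h <;> linarith

theorem threshold_zero (μ : ℝ) : threshold μ 0 = 0 := by
  rw [threshold, Real.sinh_zero, zero_pow two_ne_zero, mul_zero, zero_mul]

theorem strictMonoOn_threshold {μ : ℝ} (hμ : 0 < μ) : StrictMonoOn (threshold μ) (Set.Ici 0) := by
  intro a ha b _ hab
  have hsinh_sq {x y : ℝ} (hx : 0 ≤ x) (hxy : x < y) : Real.sinh x ^ 2 < Real.sinh y ^ 2 :=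
    pow_lt_pow_left₀ (Real.sinh_lt_sinh.2 hxy) (Real.sinh_nonneg_iff.2 hx) two_ne_zero
  have ha₂ : 0 ≤ 2 * a := mul_nonneg zero_le_two ha
  have hsqrt : √(1 + μ ^ 2 * Real.sinh (2 * a) ^ 2) < √(1 + μ ^ 2 * Real.sinh (2 * b) ^ 2) := by
    have h : Real.sinh (2 * a) ^ 2 < Real.sinh (2 * b) ^ 2 := hsinh_sq ha₂ (by linarith)
    exact Real.sqrt_lt_sqrt (by positivity) (by gcongr)
  have hone : 1 ≤ √(1 + μ ^ 2 * Real.sinh (2 * a) ^ 2) :=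
    Real.one_le_sqrt.2 (le_add_of_nonneg_right (by positivity))
  exact mul_lt_mul'' (by linarith [hsinh_sq ha hab]) (by linarith) (by positivity) (by linarith)

theorem exists_threshold_eq_one {μ : ℝ} (hμ : 0 < μ) : ∃ α, 0 < α ∧ threshold μ α = 1 := by
  have hcont : Continuous (threshold μ) := by
    have := Real.continuous_sinh
    unfold threshold
    fun_prop
  set b := Real.arsinh 1 + Real.arsinh (2 / μ)
  have h₁ : 0 < Real.arsinh 1 := Real.arsinh_pos_iff.2 one_pos
  have h₂ : 0 < Real.arsinh (2 / μ) := Real.arsinh_pos_iff.2 (by positivity)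
  have hsinh : 1 ≤ Real.sinh b := by
    rw [← Real.sinh_arsinh 1]
    exact Real.sinh_le_sinh.2 (by linarith)
  have hsinh_two_mul : 2 ≤ μ * Real.sinh (2 * b) := by
    rw [mul_comm, ← div_le_iff₀ hμ, ← Real.sinh_arsinh (2 / μ)]
    exact Real.sinh_le_sinh.2 (by linarith)
  have hsqrt : 2 ≤ √(1 + μ ^ 2 * Real.sinh (2 * b) ^ 2) := by
    rw [Real.le_sqrt (by norm_num) (by positivity)]
    nlinarith
  have hthreshold : 1 ≤ threshold μ b := by
    rw [threshold]
    nlinarith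
  obtain ⟨α, hα, h⟩ := intermediate_value_Icc (by linarith : (0 : ℝ) ≤ b) hcont.continuousOn
    ⟨(threshold_zero μ).trans_le zero_le_one, hthreshold⟩
  refine ⟨α, hα.1.lt_of_ne ?_, h⟩
  rintro rfl
  exact zero_ne_one ((threshold_zero μ).symm.trans h)

theorem strictMono_distanceOf {μ : ℝ} (hμ : 0 ≤ μ) : StrictMono (distanceOf μ) :=
  strictMono_id.add_monotone fun a b hab => by
    have hsinh : Real.sinh (2 * a) ≤ Real.sinh (2 * b) := Real.sinh_le_sinh.2 (by linarith)
    have harsinh := Real.arsinh_le_arsinh.2 (mul_le_mul_of_nonneg_left hsinh hμ)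
    linarith

theorem distanceOf_pos {μ α : ℝ} (hμ : 0 ≤ μ) (hα : 0 < α) : 0 < distanceOf μ α := by
  have h := strictMono_distanceOf hμ hα
  rwa [distanceOf, mul_zero, Real.sinh_zero, mul_zero, Real.arsinh_zero, mul_zero, add_zero] at h

end Threshold

section Discriminant

theorem discriminant_eq {M r Z c : ℝ} (hr : r ≠ 0) :
    S₁₂ M r Z c ^ 2 - S₁₁ r Z c * S₂₂ M Z c =
      Z ^ 4 * (c ^ 2 - 1) ^ 2 * (M * c - r) / r * (4 * r ^ 3 * (M * c) - (1 + r ^ 2) ^ 2) := by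
  unfold S₁₁ S₁₂ S₂₂
  field_simp
  ring

namespace IsEquilibriumData

variable {M g r Z c μ q α αs : ℝ}

theorem exists_discriminant_eq (h : IsEquilibriumData M g r Z c) : ∃ k > 0,
    S₁₂ M r Z c ^ 2 - S₁₁ r Z c * S₂₂ M Z c = k * (4 * r ^ 3 * (M * c) - (1 + r ^ 2) ^ 2) := by
  have hr := h.r_pos
  have hZ := h.Z_ne
  have hc := h.sq_sub_one_pos
  have hMc := sub_pos.2 h.r_lt_mul
  exact ⟨Z ^ 4 * (c ^ 2 - 1) ^ 2 * (M * c - r) / r, by positivity, discriminant_eq hr.ne'⟩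

theorem S₁₁_mul_S₂₂_lt_of_one_lt (h : IsEquilibriumData M g r Z c) (hr : 1 < r ^ 2) :
    S₁₁ r Z c * S₂₂ M Z c < S₁₂ M r Z c ^ 2 := by
  obtain ⟨k, hk, hdisc⟩ := h.exists_discriminant_eq
  refine sub_pos.1 (hdisc ▸ mul_pos hk (sub_pos.2 ?_))
  have hr₀ := h.r_pos
  calc (1 + r ^ 2) ^ 2 < 4 * r ^ 3 * r := by nlinarith
    _ < 4 * r ^ 3 * (M * c) := by gcongr; exact h.r_lt_mul

theorem sinh_mul_cosh_of_ratio (h : IsEquilibriumData (1 + μ) g (Real.tanh α) Z (coth q))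
    (hq : 0 < q) :
    Real.sinh q * Real.cosh (q - 2 * α) = (1 + μ) * (Real.sinh α * Real.cosh α) := by
  have hsinh : Real.sinh q ≠ 0 := (Real.sinh_pos_iff.2 hq).ne'
  have hcosh : Real.cosh α ≠ 0 := (Real.cosh_pos α).ne'
  have hratio := h.ratio
  rw [coth_sq_sub_one hq.ne', coth, Real.tanh_eq_sinh_div_cosh] at hratio
  field_simp at hratio
  rw [Real.cosh_sub, Real.cosh_two_mul, Real.sinh_two_mul]
  linear_combination hratio

theorem sinh_two_mul_sub (h : IsEquilibriumData (1 + μ) g (Real.tanh α) Z (coth q)) (hq : 0 < q) :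
    Real.sinh (2 * q - 2 * α) = μ * Real.sinh (2 * α) := by
  have hsub : Real.sinh (2 * α) = Real.sinh (q - (q - 2 * α)) := by ring_nf
  have hadd : Real.sinh (2 * q - 2 * α) = Real.sinh (q + (q - 2 * α)) := by ring_nf
  rw [Real.sinh_add] at hadd
  rw [Real.sinh_sub] at hsub
  linear_combination hadd + hsub + 2 * h.sinh_mul_cosh_of_ratio hq
    - (1 + μ) * Real.sinh_two_mul α

theorem distanceOf_eq (h : IsEquilibriumData (1 + μ) g (Real.tanh α) Z (coth q)) (hq : 0 < q) :
    distanceOf μ α = q := by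
  rw [distanceOf, ← h.sinh_two_mul_sub hq, Real.arsinh_sinh]
  ring

theorem tanh_discriminant_eq (h : IsEquilibriumData (1 + μ) g (Real.tanh α) Z (coth q))
    (hq : 0 < q) :
    4 * Real.tanh α ^ 3 * ((1 + μ) * coth q) - (1 + Real.tanh α ^ 2) ^ 2 =
      (threshold μ α - 1) / Real.cosh α ^ 4 := by
  have hsinh : Real.sinh q ≠ 0 := (Real.sinh_pos_iff.2 hq).ne'
  have hcosh : Real.cosh α ≠ 0 := (Real.cosh_pos α).ne'
  have hsqrt : √(1 + μ ^ 2 * Real.sinh (2 * α) ^ 2) = Real.cosh (2 * q - 2 * α) := by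
    rw [← mul_pow, ← h.sinh_two_mul_sub hq, ← Real.cosh_sq', Real.sqrt_sq (Real.cosh_pos _).le]
  have hprod : 2 * Real.cosh q * Real.cosh (q - 2 * α) =
      Real.cosh (2 * q - 2 * α) + Real.cosh (2 * α) := by
    have hadd : Real.cosh (2 * q - 2 * α) = Real.cosh (q + (q - 2 * α)) := by ring_nf
    have hsub : Real.cosh (2 * α) = Real.cosh (q - (q - 2 * α)) := by ring_nf
    rw [hadd, hsub, Real.cosh_add, Real.cosh_sub q (q - 2 * α)]
    ring
  rw [threshold, hsqrt, eq_sub_of_add_eq hprod.symm, coth, Real.tanh_eq_sinh_div_cosh,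
    Real.cosh_two_mul]
  field_simp
  linear_combination (-4 * Real.sinh α ^ 2 * Real.cosh q) * h.sinh_mul_cosh_of_ratio hq
    - Real.sinh q * (Real.cosh α ^ 2 + Real.sinh α ^ 2 + 1) * Real.cosh_sq α

theorem exists_sub_eq_threshold_sub (h : IsEquilibriumData (1 + μ) g r Z (coth q)) (hq : 0 < q)
    (hr : r ^ 2 < 1) : ∃ α > 0, distanceOf μ α = q ∧ ∃ k > 0,
      S₁₂ (1 + μ) r Z (coth q) ^ 2 - S₁₁ r Z (coth q) * S₂₂ (1 + μ) Z (coth q) =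
        k * (threshold μ α - 1) := by
  have hr₁ : r < 1 := (sq_lt_one_iff₀ h.r_pos.le).1 hr
  have hα : 0 < Real.artanh r := Real.artanh_pos ⟨h.r_pos, hr₁⟩
  have htanh : Real.tanh (Real.artanh r) = r := Real.tanh_artanh ⟨by linarith [h.r_pos], hr₁⟩
  obtain ⟨k, hk, hdisc⟩ := h.exists_discriminant_eq
  rw [← htanh] at h
  refine ⟨Real.artanh r, hα, h.distanceOf_eq hq, k / Real.cosh (Real.artanh r) ^ 4,
    div_pos hk (pow_pos (Real.cosh_pos _) 4), ?_⟩
  have hthreshold := h.tanh_discriminant_eq hq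
  rw [htanh] at hthreshold
  rw [hdisc, hthreshold, div_mul_eq_mul_div, mul_div_assoc]

theorem S₁₂_sq_lt_of_lt_distanceOf (h : IsEquilibriumData (1 + μ) g r Z (coth q)) (hq : 0 < q)
    (hr : r ^ 2 < 1) (hαs : 0 < αs) (hthreshold : threshold μ αs = 1) (hlt : q < distanceOf μ αs) :
    S₁₂ (1 + μ) r Z (coth q) ^ 2 < S₁₁ r Z (coth q) * S₂₂ (1 + μ) Z (coth q) := by
  have hμ : 0 < μ := by linarith [h.one_lt_M]
  obtain ⟨α, hα, rfl, k, hk, hdisc⟩ := h.exists_sub_eq_threshold_sub hq hr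
  have hαlt : α < αs := (strictMono_distanceOf hμ.le).lt_iff_lt.1 hlt
  have hneg : threshold μ α < 1 := hthreshold ▸ strictMonoOn_threshold hμ hα.le hαs.le hαlt
  exact sub_neg.1 (hdisc ▸ mul_neg_of_pos_of_neg hk (sub_neg.2 hneg))

theorem S₁₁_mul_S₂₂_lt_of_distanceOf_lt (h : IsEquilibriumData (1 + μ) g r Z (coth q)) (hq : 0 < q)
    (hr : r ^ 2 < 1) (hαs : 0 < αs) (hthreshold : threshold μ αs = 1) (hlt : distanceOf μ αs < q) :
    S₁₁ r Z (coth q) * S₂₂ (1 + μ) Z (coth q) < S₁₂ (1 + μ) r Z (coth q) ^ 2 := by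
  have hμ : 0 < μ := by linarith [h.one_lt_M]
  obtain ⟨α, hα, rfl, k, hk, hdisc⟩ := h.exists_sub_eq_threshold_sub hq hr
  have hαlt : αs < α := (strictMono_distanceOf hμ.le).lt_iff_lt.1 hlt
  have hpos : 1 < threshold μ α := hthreshold ▸ strictMonoOn_threshold hμ hαs.le hα.le hαlt
  exact sub_pos.1 (hdisc ▸ mul_pos hk (sub_pos.2 hpos))

end IsEquilibriumData

end Discriminant

end LobachevskyTwoBody

end

theorem mainTheorem3 (G μ₁ μ₂ : ℝ) (hG : 0 < G) (hμ₁ : 0 < μ₁) (hμ₂ : 0 < μ₂) :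
    -- hyperbolic relative equilibria
    (∀ (ξ : Matrix (Fin 3) (Fin 3) ℝ) (R₁ R₂ : ℝ → Vec) (t : ℝ) (z : RedVec),
      IsRelativeEquilibrium μ₁ μ₂ (gravPotential G μ₁ μ₂) ξ R₁ R₂ → IsHyperbolic ξ →
      IsReducedState μ₁ μ₂ (R₁ t) (R₂ t) (deriv R₁ t) (deriv R₂ t) z →
      IsLinearlyUnstable (redField μ₁ μ₂ (gravPotential G μ₁ μ₂)) redSpace z ∧
      IsLyapunovUnstableWithin (redField μ₁ μ₂ (gravPotential G μ₁ μ₂)) redSpace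
        {w | casimir w = casimir z} z) ∧
    -- elliptic relative equilibria
    ∃ αs qs : ℝ,
      (∀ α : ℝ, (0 < α ∧ 2 * Real.sinh α ^ 2 + 1 =
          2 * Real.sinh α ^ 2 * √(1 + (μ₁ / μ₂) ^ 2 * Real.sinh (2 * α) ^ 2)) ↔ α = αs) ∧
      qs = αs + 1 / 2 * Real.arsinh (μ₁ / μ₂ * Real.sinh (2 * αs)) ∧
      0 < qs ∧
      ∀ (ξ : Matrix (Fin 3) (Fin 3) ℝ) (R₁ R₂ : ℝ → Vec) (t : ℝ) (z : RedVec),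
        IsRelativeEquilibrium μ₁ μ₂ (gravPotential G μ₁ μ₂) ξ R₁ R₂ → IsElliptic ξ →
        IsReducedState μ₁ μ₂ (R₁ t) (R₂ t) (deriv R₁ t) (deriv R₂ t) z →
        (hdist (R₁ t) (R₂ t) < qs →
          IsLyapunovStable (redField μ₁ μ₂ (gravPotential G μ₁ μ₂)) redSpace z) ∧
        (qs < hdist (R₁ t) (R₂ t) →
          IsLinearlyUnstable (redField μ₁ μ₂ (gravPotential G μ₁ μ₂)) redSpace z ∧
          IsLyapunovUnstableWithin (redField μ₁ μ₂ (gravPotential G μ₁ μ₂)) redSpace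
            {w | casimir w = casimir z} z) := by
  refine ⟨fun ξ R₁ R₂ t z h hξ hz => ?_, ?_⟩
  · obtain ⟨r, Z, q, rfl, -, hq, hdata, -, hr⟩ := h.exists_isEquilibriumData hG hμ₁ hμ₂ hz
    have hS := hdata.S₁₁_mul_S₂₂_lt_of_one_lt (hr hξ)
    exact ⟨hdata.isLinearlyUnstable hμ₁ hq (hr hξ).ne' hS,
      hdata.isLyapunovUnstableWithin hμ₁ hq (hr hξ).ne' hS⟩
  have hμ : 0 < μ₁ / μ₂ := div_pos hμ₁ hμ₂
  obtain ⟨αs, hαs, hthreshold⟩ := exists_threshold_eq_one hμ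
  refine ⟨αs, distanceOf (μ₁ / μ₂) αs, fun α => ?_, rfl, distanceOf_pos hμ.le hαs,
    fun ξ R₁ R₂ t z h hξ hz => ?_⟩
  · rw [← threshold_eq_one_iff]
    refine ⟨fun ⟨hα, hα₁⟩ => ?_, fun hα => hα ▸ ⟨hαs, hthreshold⟩⟩
    exact (strictMonoOn_threshold hμ).injOn hα.le hαs.le (hα₁.trans hthreshold.symm)
  · obtain ⟨r, Z, q, rfl, hdist, hq, hdata, hr, -⟩ := h.exists_isEquilibriumData hG hμ₁ hμ₂ hz
    rw [hdist]
    refine ⟨fun hlt => ?_, fun hlt => ?_⟩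
    · have hS := hdata.S₁₂_sq_lt_of_lt_distanceOf hq (hr hξ) hαs hthreshold hlt
      exact hdata.isLyapunovStable hμ₁.ne' hq (hr hξ).ne hS
    · have hS := hdata.S₁₁_mul_S₂₂_lt_of_distanceOf_lt hq (hr hξ) hαs hthreshold hlt
      exact ⟨hdata.isLinearlyUnstable hμ₁ hq (hr hξ).ne hS,
        hdata.isLyapunovUnstableWithin hμ₁ hq (hr hξ).ne hS⟩
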